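/- Let $\mathbb K$ be a field of characteristic $0$ and let $(\mathcal A,A,A')$ be a quasi-twilled associative algebra over $\mathbb K$, that is, an associative (not necessarily unital) algebra $\mathcal A$ with multiplication $\Omega$ and a decomposition into subspaces $\mathcal A=A\oplus A'$ such that $A'$ is a subalgebra. Write $\Omega=\pi+\xi+\eta+\beta+\rho+\mu+\theta$ for its components $\pi\in\mathrm{Hom}(A\otimes A,A)$, $\xi\in\mathrm{Hom}(A\otimes A',A)$, $\eta\in\mathrm{Hom}(A'\otimes A,A)$, $\beta\in\mathrm{Hom}(A'\otimes A',A')$, $\rho\in\mathrm{Hom}(A\otimes A',A')$, $\mu\in\mathrm{Hom}(A'\otimes A,A')$, $\theta\in\mathrm{Hom}(A\otimes A,A')$, where a multilinear map between copies of $A$ and $A'$ is regarded as a multilinear map on $\mathcal A$ by extending it by zero on the other tensor components. Let $L=\bigoplus_{n\ge 0}\mathrm{Hom}(\otimes^{n+1}\mathcal A,\mathcal A)$, with $\mathrm{Hom}(\otimes^{n+1}\mathcal A,\mathcal A)$ in degree $n$, equipped with the Gerstenhaber bracket: for $f\in\mathrm{Hom}(\otimes^{m}\mathcal A,\mathcal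 A)$ and $g\in\mathrm{Hom}(\otimes^{n}\mathcal A,\mathcal A)$, $$[f,g]_G=f\circ g-(-1)^{(m-1)(n-1)}g\circ f,\qquad f\circ g(x_1,\dots,x_{m+n-1})=\sum_{i=1}^{m}(-1)^{(i-1)(n-1)}f(x_1,\dots,x_{i-1},g(x_i,\dots,x_{i+n-1}),x_{i+n},\dots,x_{m+n-1}).$$ Let $F=\bigoplus_{n\ge 0}\mathrm{Hom}(\otimes^{n+1}A',A)\subseteq L$, let $P:L\to L$ be the projection onto $F$ along the other components, and let $\Delta=\Omega=\pi+\xi+\eta+\beta+\rho+\mu+\theta$. (1) $(L,F,P,\Delta)$ is a V-data: $(L,[\cdot,\cdot]_G)$ is a graded Lie algebra, $F$ is an abelian graded Lie subalgebra, $P\circ P=P$, the image of $P$ is $F$ and its kernel is a graded Lie subalgebra, $\Delta\in L^1$, $[\Delta,\Delta]_G=0$ and $P(\Delta)=0$. (2) Consequently, the operations $l_0=P(\Delta)$ and $l_k(f_1,\dots,f_k)=P[\cdots[[\Delta,f_1]_G,f_2]_G,\cdots,f_k]_G$ $(k\ge 1)$ make $F$ an $L_\infty$-algebra: $l_0=0$,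 every $l_k$ is multilinear of degree $1$ and graded symmetric, and for all $n\ge 0$ and homogeneous $x_1,\dots,x_n\in F$ $$\sum_{i=0}^{n}\ \sum_{\sigma\in S(i,n-i)}\varepsilon(\sigma)\,l_{n-i+1}(l_i(x_{\sigma(1)},\dots,x_{\sigma(i)}),x_{\sigma(i+1)},\dots,x_{\sigma(n)})=0,$$ where $S(i,n-i)$ is the set of $(i,n-i)$-shuffles and $\varepsilon(\sigma)$ is the Koszul sign. Moreover, for all $f,f_1,f_2,f_3\in F$, $$l_1(f)=[\xi+\eta+\beta,f]_G,\qquad l_2(f_1,f_2)=[[\pi+\rho+\mu,f_1]_G,f_2]_G,\qquad l_3(f_1,f_2,f_3)=[[[\theta,f_1]_G,f_2]_G,f_3]_G,$$ and $l_k=0$ for all $k\ge 4$. (3) A linear map $B:A'\to A$ is a left deformation map of $(\mathcal A,A,A')$, that is, $$\pi(B(u),B(v))+\xi(B(u),v)+\eta(u,B(v))=B\big(\beta(u,v)+\rho(B(u),v)+\mu(u,B(v))+\theta(B(u),B(v))\big)\qquad\text{for all }u,v\in A',$$ if and only if $B$ is a Maurer--Cartan element of this $L_\infty$-algebra, that is,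 an element of degree $0$ of $F$ with $\sum_{k\ge 1}\frac{1}{k!}\,l_k(B,\dots,B)=0$. -/

import Mathlib

open scoped DirectSum

/-! ### Graded Lie algebras -/

/-- `(L, [·,·])` is a graded Lie algebra with respect to the `ℤ`-grading `𝓖`. -/
structure IsGradedLieAlgebra {K L : Type*} [Field K] [AddCommGroup L] [Module K L]
    (𝓖 : ℤ → Submodule K L) (br : L →ₗ[K] L →ₗ[K] L) : Prop where
  isInternal : DirectSum.IsInternal 𝓖
  bracket_mem : ∀ (a b : ℤ) (x y : L), x ∈ 𝓖 a → y ∈ 𝓖 b → br x y ∈ 𝓖 (a + b)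
  antisymm : ∀ (a b : ℤ) (x y : L), x ∈ 𝓖 a → y ∈ 𝓖 b →
    br x y = -((a * b).negOnePow • br y x)
  jacobi : ∀ (a b c : ℤ) (x y z : L), x ∈ 𝓖 a → y ∈ 𝓖 b → z ∈ 𝓖 c →
    br x (br y z) = br (br x y) z + (a * b).negOnePow • br y (br x z)

/-- A graded Lie subalgebra: a subspace spanned by its homogeneous elements and closed under
the bracket. -/
structure IsGradedLieSubalgebra {K L : Type*} [Field K] [AddCommGroup L] [Module K L]
    (𝓖 : ℤ → Submodule K L) (br : L →ₗ[K] L →ₗ[K] L) (S : Submodule K L) : Prop where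
  homogeneous : S = ⨆ k : ℤ, S ⊓ 𝓖 k
  bracket_mem : ∀ x ∈ S, ∀ y ∈ S, br x y ∈ S

/-! ### Curved `L∞`-algebras and Maurer-Cartan elements -/

/-- The Koszul sign `ε(σ; x₁, …, xₙ)` for homogeneous elements of degrees `d`. -/
def koszulSign {n : ℕ} (d : Fin n → ℤ) (σ : Equiv.Perm (Fin n)) : ℤˣ :=
  ∏ p : Fin n × Fin n,
    if p.1 < p.2 ∧ σ p.2 < σ p.1 then (d (σ p.1) * d (σ p.2)).negOnePow else 1

/-- `σ` is an `(i, n-i)`-shuffle: it is increasing on the first `i` and on the last `n-i`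
positions. -/
def IsShuffle {n : ℕ} (i : ℕ) (σ : Equiv.Perm (Fin n)) : Prop :=
  ∀ a b : Fin n, a < b → ((b : ℕ) < i ∨ i ≤ (a : ℕ)) → σ a < σ b

open Classical in
/-- The set `S(i, n-i)` of `(i, n-i)`-shuffles. -/
noncomputable def shuffles (n i : ℕ) : Finset (Equiv.Perm (Fin n)) :=
  Finset.univ.filter fun σ => IsShuffle i σ

/-- `(V, {l_k}_{k ≥ 0})` is a curved `L∞`-algebra (with graded symmetric operations of
degree `1`) with respect to the `ℤ`-grading `𝓖`. -/
structure IsCurvedLInfinity {K V : Type*} [Field K] [AddCommGroup V] [Module K V]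
    (𝓖 : ℤ → Submodule K V) (l : (k : ℕ) → MultilinearMap K (fun _ : Fin k => V) V) :
    Prop where
  isInternal : DirectSum.IsInternal 𝓖
  degree_one : ∀ (n : ℕ) (d : Fin n → ℤ) (x : Fin n → V), (∀ a, x a ∈ 𝓖 (d a)) →
    l n x ∈ 𝓖 ((∑ a, d a) + 1)
  graded_symm : ∀ (n : ℕ) (d : Fin n → ℤ) (x : Fin n → V), (∀ a, x a ∈ 𝓖 (d a)) →
    ∀ σ : Equiv.Perm (Fin n), l n (fun a => x (σ a)) = koszulSign d σ • l n x
  jacobi : ∀ (n : ℕ) (d : Fin n → ℤ) (x : Fin n → V), (∀ a, x a ∈ 𝓖 (d a)) →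
    ∑ i : Fin (n + 1), ∑ σ ∈ shuffles n i,
      koszulSign d σ •
        l (n - i + 1) (Fin.cons
          (l i fun a : Fin i => x (σ ⟨a, by omega⟩))
          (fun b : Fin (n - i) => x (σ ⟨i + b, by omega⟩))) = 0

/-- An `L∞`-algebra is a curved `L∞`-algebra with `l₀ = 0`. -/
structure IsLInfinity {K V : Type*} [Field K] [AddCommGroup V] [Module K V]
    (𝓖 : ℤ → Submodule K V) (l : (k : ℕ) → MultilinearMap K (fun _ : Fin k => V) V) : Prop
    extends IsCurvedLInfinity 𝓖 l where
  curvature_eq_zero : l 0 = 0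

/-- A Maurer-Cartan element of `(V, {l_k})`: a degree `0` element `x` for which
`l₀ + ∑_{k ≥ 1} (1/k!) l_k(x, …, x)` is a finite sum and vanishes. -/
structure IsMaurerCartan {K V : Type*} [Field K] [AddCommGroup V] [Module K V]
    (𝓖 : ℤ → Submodule K V) (l : (k : ℕ) → MultilinearMap K (fun _ : Fin k => V) V)
    (x : V) : Prop where
  degree_zero : x ∈ 𝓖 0
  finite : {k : ℕ | (k.factorial : K)⁻¹ • l k (fun _ => x) ≠ 0}.Finite
  equation : ∑ᶠ k : ℕ, (k.factorial : K)⁻¹ • l k (fun _ => x) = 0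

/-! ### V-data and derived brackets -/

/-- `(L, F, P, Δ)` is a curved V-data, where `L` is graded by `𝓖` and has bracket `br`. -/
structure IsCurvedVData {K L : Type*} [Field K] [AddCommGroup L] [Module K L]
    (𝓖 : ℤ → Submodule K L) (br : L →ₗ[K] L →ₗ[K] L) (F : Submodule K L)
    (P : L →ₗ[K] L) (Δ : L) : Prop where
  gradedLie : IsGradedLieAlgebra 𝓖 br
  subalgebra : IsGradedLieSubalgebra 𝓖 br F
  abelian : ∀ x ∈ F, ∀ y ∈ F, br x y = 0
  proj : P ∘ₗ P = P
  range_proj : LinearMap.range P = F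
  ker_proj : IsGradedLieSubalgebra 𝓖 br (LinearMap.ker P)
  degree_one : Δ ∈ 𝓖 1
  square_zero : br Δ Δ = 0

/-- A V-data is a curved V-data with `Δ ∈ ker P`. -/
structure IsVData {K L : Type*} [Field K] [AddCommGroup L] [Module K L]
    (𝓖 : ℤ → Submodule K L) (br : L →ₗ[K] L →ₗ[K] L) (F : Submodule K L)
    (P : L →ₗ[K] L) (Δ : L) : Prop extends IsCurvedVData 𝓖 br F P Δ where
  mem_ker : P Δ = 0

/-- The multilinear map `(x₁, …, x_k) ↦ [⋯[[Δ, x₁], x₂], ⋯, x_k]`. -/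
noncomputable def iteratedBracket {K L : Type*} [Field K] [AddCommGroup L] [Module K L]
    (br : L →ₗ[K] L →ₗ[K] L) (Δ : L) :
    (k : ℕ) → MultilinearMap K (fun _ : Fin k => L) L
  | 0 => MultilinearMap.constOfIsEmpty K _ Δ
  | k + 1 =>
      MultilinearMap.uncurryRight (M := fun _ : Fin (k + 1) => L)
        (br.compMultilinearMap (iteratedBracket br Δ k))

/-- The higher derived brackets `l_k(x₁, …, x_k) = P [⋯[[Δ, x₁], x₂], ⋯, x_k]` on `F`. -/
noncomputable def derivedBracket {K L : Type*} [Field K] [AddCommGroup L] [Module K L]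
    (br : L →ₗ[K] L →ₗ[K] L) (F : Submodule K L) (P : L →ₗ[K] L) (hP : ∀ x, P x ∈ F)
    (Δ : L) (k : ℕ) : MultilinearMap K (fun _ : Fin k => F) F :=
  (P.codRestrict F hP).compMultilinearMap
    ((iteratedBracket br Δ k).compLinearMap fun _ => F.subtype)

/-- The grading that a grading of `L` induces on a subspace `F`. -/
def inducedGrading {K L : Type*} [Field K] [AddCommGroup L] [Module K L]
    (𝓖 : ℤ → Submodule K L) (F : Submodule K L) (k : ℤ) : Submodule K F :=
  (𝓖 k).comap F.subtype

/-! ### Cochains and the Gerstenhaber bracket -/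

/-- `Hom(⊗^{n+1} V, W)`, the cochains of degree `n`. -/
abbrev Cochain (K V W : Type*) [Field K] [AddCommGroup V] [Module K V] [AddCommGroup W]
    [Module K W] (n : ℕ) : Type _ :=
  MultilinearMap K (fun _ : Fin (n + 1) => V) W

/-- The space `⊕_{n ≥ 0} Hom(⊗^{n+1} V, W)`. -/
def CochainSum (K V W : Type*) [Field K] [AddCommGroup V] [Module K V] [AddCommGroup W]
    [Module K W] : Type _ :=
  ⨁ n : ℕ, Cochain K V W n

namespace CochainSum

variable {K V W : Type*} [Field K] [AddCommGroup V] [Module K V] [AddCommGroup W] [Module K W]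

noncomputable instance : AddCommGroup (CochainSum K V W) :=
  inferInstanceAs (AddCommGroup (⨁ n : ℕ, Cochain K V W n))

noncomputable instance : Module K (CochainSum K V W) :=
  inferInstanceAs (Module K (⨁ n : ℕ, Cochain K V W n))

/-- The inclusion of `Hom(⊗^{n+1} V, W)` into the direct sum. -/
noncomputable def of (n : ℕ) : Cochain K V W n →ₗ[K] CochainSum K V W :=
  DirectSum.lof K ℕ (Cochain K V W) n

/-- The linear map on the direct sum that is `φ n` on `Hom(⊗^{n+1} V, W)`. -/
noncomputable def desc {M : Type*} [AddCommGroup M] [Module K M]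
    (φ : (n : ℕ) → Cochain K V W n →ₗ[K] M) : CochainSum K V W →ₗ[K] M :=
  DirectSum.toModule K ℕ M φ

theorem desc_of {M : Type*} [AddCommGroup M] [Module K M]
    (φ : (n : ℕ) → Cochain K V W n →ₗ[K] M) (n : ℕ) (f : Cochain K V W n) :
    desc φ (of n f) = φ n f :=
  DirectSum.toModule_lof K n f

theorem hom_ext {M : Type*} [AddCommGroup M] [Module K M] {φ ψ : CochainSum K V W →ₗ[K] M}
    (h : ∀ (n : ℕ) (f : Cochain K V W n), φ (of n f) = ψ (of n f)) : φ = ψ :=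
  DirectSum.linearMap_ext K fun n => LinearMap.ext (h n)

end CochainSum

/-- The `ℤ`-grading of `⊕_{n ≥ 0} Hom(⊗^{n+1} V, W)` by degree; it is zero in negative
degrees. -/
noncomputable def cochainGrading (K V W : Type*) [Field K] [AddCommGroup V] [Module K V] [AddCommGroup W]
    [Module K W] : ℤ → Submodule K (CochainSum K V W)
  | Int.ofNat n => LinearMap.range (CochainSum.of n)
  | Int.negSucc _ => ⊥

/-- The arguments `(x₀, …, x_{i-1}, v, x_{i+n+1}, …, x_{m+n})` (numbering from `0`). -/
def insertArgs {V : Type*} {m n : ℕ} (i : Fin (m + 1)) (x : Fin (m + n + 1) → V) (v : V) :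
    Fin (m + 1) → V := fun j =>
  if j < i then x ⟨j, by omega⟩ else if j = i then v else x ⟨j + n, by omega⟩

/-- The arguments `(x_i, …, x_{i+n})`. -/
def blockArgs {V : Type*} {m n : ℕ} (i : Fin (m + 1)) (x : Fin (m + n + 1) → V) : Fin (n + 1) → V :=
  fun k => x ⟨i + k, by omega⟩


theorem insertArgs_update_value {V : Type*} {m n : ℕ} (i : Fin (m + 1)) (x : Fin (m + n + 1) → V)
    (v w : V) : insertArgs i x v = Function.update (insertArgs i x w) i v := by
  funext j
  by_cases h : j = i
  · subst h
    simp [insertArgs]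
  · simp [insertArgs, h]

section Gerstenhaber

variable {K V : Type*} [Field K] [AddCommGroup V] [Module K V]

theorem exists_insertArgs_update {m n : ℕ} (i : Fin (m + 1)) (g : Cochain K V V n)
    (x : Fin (m + n + 1) → V) (k : Fin (m + n + 1)) :
    ∃ (j : Fin (m + 1)) (φ : V →ₗ[K] V), ∀ a : V,
      insertArgs i (Function.update x k a) (g (blockArgs i (Function.update x k a))) =
        Function.update (insertArgs i x (g (blockArgs i x))) j (φ a) := by
  by_cases h₁ : (k : ℕ) < i
  · refine ⟨⟨k, by omega⟩, LinearMap.id, fun a => ?_⟩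
    have hb : blockArgs i (Function.update x k a) = blockArgs i x := by
      funext t
      refine Function.update_of_ne ?_ _ _
      simp only [ne_eq, Fin.ext_iff]
      omega
    rw [hb]
    funext j
    simp only [insertArgs, Function.update_apply, Fin.ext_iff, Fin.lt_def, LinearMap.id_apply]
    split_ifs <;> first | rfl | omega
  by_cases h₂ : (k : ℕ) ≤ i + n
  · refine ⟨i, g.toLinearMap (blockArgs i x) ⟨k - i, by omega⟩, fun a => ?_⟩
    have hb : blockArgs i (Function.update x k a) =
        Function.update (blockArgs i x) ⟨k - i, by omega⟩ a := by
      funext t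
      simp only [blockArgs, Function.update_apply, Fin.ext_iff]
      split_ifs <;> first | rfl | omega
    rw [hb]
    funext j
    simp only [insertArgs, Function.update_apply, Fin.ext_iff, Fin.lt_def,
      MultilinearMap.toLinearMap_apply]
    split_ifs <;> first | rfl | omega
  · refine ⟨⟨k - n, by omega⟩, LinearMap.id, fun a => ?_⟩
    have hb : blockArgs i (Function.update x k a) = blockArgs i x := by
      funext t
      refine Function.update_of_ne ?_ _ _
      simp only [ne_eq, Fin.ext_iff]
      omega
    rw [hb]
    funext j
    simp only [insertArgs, Function.update_apply, Fin.ext_iff, Fin.lt_def, LinearMap.id_apply]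
    split_ifs <;> first | rfl | omega

/-- The partial composition
`(x₀, …, x_{m+n}) ↦ f(x₀, …, x_{i-1}, g(x_i, …, x_{i+n}), x_{i+n+1}, …, x_{m+n})`. -/
def partialComp {m n : ℕ} (i : Fin (m + 1)) (f : Cochain K V V m) (g : Cochain K V V n) :
    Cochain K V V (m + n) :=
  MultilinearMap.mk' (fun x => f (insertArgs i x (g (blockArgs i x))))
    (fun x k a b => by
      obtain ⟨j, φ, h⟩ := exists_insertArgs_update i g x k
      rw [h, h, h, map_add, MultilinearMap.map_update_add])
    (fun x k c a => by
      obtain ⟨j, φ, h⟩ := exists_insertArgs_update i g x k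
      rw [h, h, map_smul, MultilinearMap.map_update_smul])

theorem partialComp_apply {m n : ℕ} (i : Fin (m + 1)) (f : Cochain K V V m)
    (g : Cochain K V V n) (x : Fin (m + n + 1) → V) :
    partialComp i f g x = f (insertArgs i x (g (blockArgs i x))) := rfl

/-- The partial composition as a bilinear map. -/
def partialCompₗ {m n : ℕ} (i : Fin (m + 1)) :
    Cochain K V V m →ₗ[K] Cochain K V V n →ₗ[K] Cochain K V V (m + n) :=
  LinearMap.mk₂ K (partialComp i)
    (fun _ _ _ => MultilinearMap.ext fun _ => rfl)
    (fun _ _ _ => MultilinearMap.ext fun _ => rfl)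
    (fun f g g' => MultilinearMap.ext fun x => by
      simp only [add_apply, partialComp_apply]
      rw [insertArgs_update_value i x (_ + _) 0, MultilinearMap.map_update_add,
        ← insertArgs_update_value, ← insertArgs_update_value])
    (fun c f g => MultilinearMap.ext fun x => by
      simp only [smul_apply, partialComp_apply]
      rw [insertArgs_update_value i x (_ • _) 0, MultilinearMap.map_update_smul,
        ← insertArgs_update_value])

/-- The circle product `f ∘ g = ∑ᵢ (-1)^{i n} f(x₀, …, g(x_i, …, x_{i+n}), …, x_{m+n})` of
cochains of degrees `m` and `n` (arguments numbered from `0`). -/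
def circ (m n : ℕ) : Cochain K V V m →ₗ[K] Cochain K V V n →ₗ[K] Cochain K V V (m + n) :=
  ∑ i : Fin (m + 1), (-1 : K) ^ ((i : ℕ) * n) • partialCompₗ i

/-- The Gerstenhaber bracket `[f, g] = f ∘ g - (-1)^{m n} g ∘ f` of cochains of degrees `m`
and `n`, as an element of the direct sum. -/
noncomputable def homogeneousBracket (m n : ℕ) :
    Cochain K V V m →ₗ[K] Cochain K V V n →ₗ[K] CochainSum K V V :=
  (circ m n).compr₂ (CochainSum.of (m + n)) -
    (-1 : K) ^ (m * n) • (circ n m).flip.compr₂ (CochainSum.of (n + m))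

/-- The Gerstenhaber bracket on `⊕_{n ≥ 0} Hom(⊗^{n+1} V, V)`. -/
noncomputable def gerstenhaberBracket (K V : Type*) [Field K] [AddCommGroup V] [Module K V] :
    CochainSum K V V →ₗ[K] CochainSum K V V →ₗ[K] CochainSum K V V :=
  CochainSum.desc fun m => (CochainSum.desc fun n => (homogeneousBracket m n).flip).flip

/-- A bilinear map as an element of `Hom(V ⊗ V, V)`, in degree `1`. -/
noncomputable def bilinCochain (f : V →ₗ[K] V →ₗ[K] V) : CochainSum K V V :=
  CochainSum.of 1
    (MultilinearMap.mk' (fun x => f (x 0) (x 1))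
      (fun x k a b => by fin_cases k <;> simp)
      (fun x k c a => by fin_cases k <;> simp))

end Gerstenhaber

/-! ### Quasi-twilled associative algebras -/

/-- A quasi-twilled associative algebra `(𝒜, A, A')`: an associative (not necessarily unital)
algebra with a decomposition `𝒜 = A ⊕ A'` into subspaces such that `A'` is a subalgebra. -/
structure QuasiTwilledAlgebra (K 𝒜 : Type*) [Field K] [NonUnitalRing 𝒜] [Module K 𝒜]
    [IsScalarTower K 𝒜 𝒜] [SMulCommClass K 𝒜 𝒜] where
  A : Submodule K 𝒜
  A' : Submodule K 𝒜
  isCompl : IsCompl A A'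
  mul_mem : ∀ u ∈ A', ∀ v ∈ A', u * v ∈ A'

namespace QuasiTwilledAlgebra

variable {K 𝒜 : Type*} [Field K] [NonUnitalRing 𝒜] [Module K 𝒜]
  [IsScalarTower K 𝒜 𝒜] [SMulCommClass K 𝒜 𝒜] (T : QuasiTwilledAlgebra K 𝒜)

/-- The projection of `𝒜 = A ⊕ A'` onto `A`. -/
noncomputable def projA : 𝒜 →ₗ[K] T.A := T.A.projectionOnto T.A' T.isCompl

/-- The projection of `𝒜 = A ⊕ A'` onto `A'`. -/
noncomputable def projA' : 𝒜 →ₗ[K] T.A' := T.A'.projectionOnto T.A T.isCompl.symm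

/-- The `A`-component of the product of `x ∈ A` and `y ∈ A`. -/
noncomputable def π : T.A →ₗ[K] T.A →ₗ[K] T.A :=
  ((LinearMap.mul K 𝒜).compl₁₂ T.A.subtype T.A.subtype).compr₂ T.projA

/-- The `A`-component of the product of `x ∈ A` and `v ∈ A'`. -/
noncomputable def ξ : T.A →ₗ[K] T.A' →ₗ[K] T.A :=
  ((LinearMap.mul K 𝒜).compl₁₂ T.A.subtype T.A'.subtype).compr₂ T.projA

/-- The `A`-component of the product of `u ∈ A'` and `y ∈ A`. -/
noncomputable def η : T.A' →ₗ[K] T.A →ₗ[K] T.A :=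
  ((LinearMap.mul K 𝒜).compl₁₂ T.A'.subtype T.A.subtype).compr₂ T.projA

/-- The `A'`-component of the product of `u ∈ A'` and `v ∈ A'`. -/
noncomputable def β : T.A' →ₗ[K] T.A' →ₗ[K] T.A' :=
  ((LinearMap.mul K 𝒜).compl₁₂ T.A'.subtype T.A'.subtype).compr₂ T.projA'

/-- The `A'`-component of the product of `x ∈ A` and `v ∈ A'`. -/
noncomputable def ρ : T.A →ₗ[K] T.A' →ₗ[K] T.A' :=
  ((LinearMap.mul K 𝒜).compl₁₂ T.A.subtype T.A'.subtype).compr₂ T.projA'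

/-- The `A'`-component of the product of `u ∈ A'` and `y ∈ A`. -/
noncomputable def μ : T.A' →ₗ[K] T.A →ₗ[K] T.A' :=
  ((LinearMap.mul K 𝒜).compl₁₂ T.A'.subtype T.A.subtype).compr₂ T.projA'

/-- The `A'`-component of the product of `x ∈ A` and `y ∈ A`. -/
noncomputable def θ : T.A →ₗ[K] T.A →ₗ[K] T.A' :=
  ((LinearMap.mul K 𝒜).compl₁₂ T.A.subtype T.A.subtype).compr₂ T.projA'

/-- The graded vector space `L = ⊕_{n ≥ 0} Hom(⊗^{n+1} 𝒜, 𝒜)`. -/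
abbrev L (_T : QuasiTwilledAlgebra K 𝒜) : Type _ := CochainSum K 𝒜 𝒜

/-- The multiplication `Ω` of `𝒜`, as an element of `L`. -/
noncomputable def Ω : T.L := bilinCochain (LinearMap.mul K 𝒜)

/-- The lift of `π` to an element of `L`; similarly for the other components. -/
noncomputable def πL : T.L :=
  bilinCochain ((T.π.compl₁₂ T.projA T.projA).compr₂ T.A.subtype)

noncomputable def ξL : T.L :=
  bilinCochain ((T.ξ.compl₁₂ T.projA T.projA').compr₂ T.A.subtype)

noncomputable def ηL : T.L :=
  bilinCochain ((T.η.compl₁₂ T.projA' T.projA).compr₂ T.A.subtype)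

noncomputable def βL : T.L :=
  bilinCochain ((T.β.compl₁₂ T.projA' T.projA').compr₂ T.A'.subtype)

noncomputable def ρL : T.L :=
  bilinCochain ((T.ρ.compl₁₂ T.projA T.projA').compr₂ T.A'.subtype)

noncomputable def μL : T.L :=
  bilinCochain ((T.μ.compl₁₂ T.projA' T.projA).compr₂ T.A'.subtype)

noncomputable def θL : T.L :=
  bilinCochain ((T.θ.compl₁₂ T.projA T.projA).compr₂ T.A'.subtype)

/-- The lift of `f ∈ Hom(⊗^{n+1} A', A)` to `Hom(⊗^{n+1} 𝒜, 𝒜)`: it is `f` on `⊗^{n+1} A'`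
and vanishes when some argument is in `A`. -/
noncomputable def lift (n : ℕ) : Cochain K T.A' T.A n →ₗ[K] Cochain K 𝒜 𝒜 n where
  toFun f := T.A.subtype.compMultilinearMap (f.compLinearMap fun _ => T.projA')
  map_add' _ _ := rfl
  map_smul' _ _ := rfl

/-- The `Hom(⊗^{n+1} A', A)`-component of an element of `Hom(⊗^{n+1} 𝒜, 𝒜)`. -/
noncomputable def component (n : ℕ) : Cochain K 𝒜 𝒜 n →ₗ[K] Cochain K T.A' T.A n where
  toFun f := T.projA.compMultilinearMap (f.compLinearMap fun _ => T.A'.subtype)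
  map_add' _ _ := MultilinearMap.ext fun _ => map_add T.projA _ _
  map_smul' _ _ := MultilinearMap.ext fun _ => map_smul T.projA _ _

/-- The lift `⊕_{n ≥ 0} Hom(⊗^{n+1} A', A) → L`. -/
noncomputable def liftSum : CochainSum K T.A' T.A →ₗ[K] T.L :=
  CochainSum.desc fun n => CochainSum.of n ∘ₗ T.lift n

/-- The map `L → ⊕_{n ≥ 0} Hom(⊗^{n+1} A', A)` that takes components. -/
noncomputable def componentSum : T.L →ₗ[K] CochainSum K T.A' T.A :=
  CochainSum.desc fun n => CochainSum.of n ∘ₗ T.component n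

theorem componentSum_liftSum (f : CochainSum K T.A' T.A) :
    T.componentSum (T.liftSum f) = f := by
  have h : T.componentSum ∘ₗ T.liftSum = LinearMap.id := by
    refine CochainSum.hom_ext fun n f => ?_
    simp only [componentSum, liftSum, LinearMap.comp_apply, CochainSum.desc_of,
      LinearMap.id_apply]
    congr 1
    refine MultilinearMap.ext fun u => ?_
    simp [component, lift, projA, projA']
  exact LinearMap.congr_fun h f

/-- `F = ⊕_{n ≥ 0} Hom(⊗^{n+1} A', A)` as a subspace of `L`. -/
noncomputable def F : Submodule K T.L := LinearMap.range T.liftSum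

/-- The identification of `⊕_{n ≥ 0} Hom(⊗^{n+1} A', A)` with the subspace `F` of `L`. -/
noncomputable def toF : CochainSum K T.A' T.A ≃ₗ[K] T.F :=
  LinearEquiv.ofInjective T.liftSum (Function.LeftInverse.injective T.componentSum_liftSum)

/-- The projection `P : L → L` onto `F`, along the other components of `L`. -/
noncomputable def P : T.L →ₗ[K] T.L := T.liftSum ∘ₗ T.componentSum

theorem P_mem (f : T.L) : T.P f ∈ T.F := ⟨T.componentSum f, rfl⟩

/-- The grading of `L`, and the one it induces on `F`. -/
noncomputable def gradingL : ℤ → Submodule K T.L := cochainGrading K 𝒜 𝒜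

noncomputable def gradingF : ℤ → Submodule K T.F := inducedGrading T.gradingL T.F

/-- The Gerstenhaber bracket of `L`. -/
noncomputable def bracket : T.L →ₗ[K] T.L →ₗ[K] T.L := gerstenhaberBracket K 𝒜

/-- The operations `l_k(f₁, …, f_k) = P [⋯[[Ω, f₁], f₂], ⋯, f_k]` on `F`. -/
noncomputable def l (k : ℕ) : MultilinearMap K (fun _ : Fin k => T.F) T.F :=
  derivedBracket T.bracket T.F T.P T.P_mem T.Ω k

/-- A left deformation map of `(𝒜, A, A')`. -/
def IsLeftDeformationMap (B : T.A' →ₗ[K] T.A) : Prop :=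
  ∀ u v : T.A',
    T.π (B u) (B v) + T.ξ (B u) v + T.η u (B v) =
      B (T.β u v + T.ρ (B u) v + T.μ u (B v) + T.θ (B u) (B v))

/-- A linear map `B : A' → A` as an element of `F`, in `Hom(⊗^1 A', A)`. -/
noncomputable def ofMap (B : T.A' →ₗ[K] T.A) : T.F :=
  T.toF (CochainSum.of 0
    (MultilinearMap.ofSubsingleton K T.A' T.A (0 : Fin 1) B))

end QuasiTwilledAlgebra

/-!
Write `Δ_s` for the iterated bracket of `Δ` with the `x_k`, `k ∈ s`. Expanding
`0 = P [⋯[[Δ, Δ], x₁], ⋯, x_n]` by the Leibniz rule gives a signed sum of terms `P [Δ_s, Δ_t]` over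
the splittings of `{1, …, n}` into `s` and `t`. Since `ker P` is a subalgebra and `F` is abelian,
`P [u, v] = P [P u, v] + P [u, P v]`, and `[Δ_t, P Δ_s] = ± [Δ, P Δ_s]_t`. So each term of the
generalized Jacobi identity occurs twice, and `2` is invertible. The Jacobi identity of the
Gerstenhaber bracket comes from the pre-Lie identity of the circle product.

Let `e` be the projection of `𝒜` onto `A`, in degree `0`. The derivation `[e, ·]` is `1` on `F`,
`0` on `ξ`, `η`, `β`, `-1` on `π`, `ρ`, `μ` and `-2` on `θ`. As `F` is its whole eigenspace for the
eigenvalue `1` and `P` kills the other eigenspaces, only one part of `Ω` contributes to each `l_k`.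

For `B : A' → A` let `t` be its extension by zero to `𝒜`. Then `t² = 0`, and the Maurer-Cartan sum
is the restriction to `A'` of the `A`-component of `exp (-t) (exp t x · exp t y)`. It vanishes when
the graph of `B`, the image of `A'` under `exp t`, is a subalgebra. Written out in components, this
is the equation of a left deformation map.
-/

/-! ### Homogeneous subspaces of graded vector spaces -/

section Homogeneous

variable {K L : Type*} [Field K] [AddCommGroup L] [Module K L] {𝓖 : ℤ → Submodule K L}

theorem range_eq_iSup_inf (h𝓖 : ⨆ k, 𝓖 k = ⊤) {φ : L →ₗ[K] L}
    (hφ : ∀ k, ∀ u ∈ 𝓖 k, φ u ∈ 𝓖 k) :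
    LinearMap.range φ = ⨆ k, LinearMap.range φ ⊓ 𝓖 k := by
  refine le_antisymm ?_ (iSup_le fun _ => inf_le_left)
  calc LinearMap.range φ = ⨆ k, (𝓖 k).map φ := by
        rw [← Submodule.map_iSup, h𝓖, LinearMap.range_eq_map]
    _ ≤ ⨆ k, LinearMap.range φ ⊓ 𝓖 k := iSup_mono fun k => ?_
  rintro _ ⟨u, hu, rfl⟩
  exact ⟨LinearMap.mem_range_self φ u, hφ k u hu⟩

theorem ker_eq_iSup_inf (h𝓖 : ⨆ k, 𝓖 k = ⊤) {P : L →ₗ[K] L} (hP : IsIdempotentElem P)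
    (hdeg : ∀ k, ∀ u ∈ 𝓖 k, P u ∈ 𝓖 k) :
    LinearMap.ker P = ⨆ k, LinearMap.ker P ⊓ 𝓖 k := by
  rw [LinearMap.IsIdempotentElem.ker_eq_range hP]
  exact range_eq_iSup_inf h𝓖 fun k u hu => sub_mem hu (hdeg k u hu)

-- By independence, `𝓖 k` is the sum of its intersections with the range and the kernel.
theorem apply_mem_of_range_of_ker (h𝓖 : iSupIndep 𝓖) {P : L →ₗ[K] L}
    (hP : IsIdempotentElem P) (hrange : LinearMap.range P = ⨆ k, LinearMap.range P ⊓ 𝓖 k)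
    (hker : LinearMap.ker P = ⨆ k, LinearMap.ker P ⊓ 𝓖 k) {k : ℤ} {u : L} (hu : u ∈ 𝓖 k) :
    P u ∈ 𝓖 k := by
  have hsup : ⨆ k, LinearMap.range P ⊓ 𝓖 k ⊔ LinearMap.ker P ⊓ 𝓖 k = ⊤ := by
    rw [iSup_sup_eq, ← hrange, ← hker, (LinearMap.IsIdempotentElem.isCompl hP).sup_eq_top]
  have hle : (fun k => LinearMap.range P ⊓ 𝓖 k ⊔ LinearMap.ker P ⊓ 𝓖 k) ≤ 𝓖 := fun _ =>
    sup_le inf_le_right inf_le_right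
  rw [← (h𝓖.le_iff_eq_of_iSup_eq_top hsup).mp hle] at hu
  obtain ⟨f, hf, g, hg, rfl⟩ := Submodule.mem_sup.mp hu
  rw [map_add, (LinearMap.IsIdempotentElem.mem_range_iff hP).mp hf.1,
    LinearMap.mem_ker.mp hg.1, add_zero]
  exact hf.2

theorem isInternal_inducedGrading (h𝓖 : DirectSum.IsInternal 𝓖) {F : Submodule K L}
    (hF : F = ⨆ k, F ⊓ 𝓖 k) : DirectSum.IsInternal (inducedGrading 𝓖 F) := by
  have hmap : ∀ k, (inducedGrading 𝓖 F k).map F.subtype = F ⊓ 𝓖 k := fun k =>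
    Submodule.map_comap_subtype _ _
  rw [DirectSum.isInternal_submodule_iff_iSupIndep_and_iSup_eq_top] at h𝓖 ⊢
  constructor
  · refine fun k => disjoint_iff.mpr (Submodule.map_injective_of_injective F.subtype_injective ?_)
    simp only [Submodule.map_inf _ F.subtype_injective, Submodule.map_iSup, hmap,
      Submodule.map_bot]
    exact disjoint_iff.mp ((h𝓖.1 k).mono inf_le_right (iSup₂_mono fun _ _ => inf_le_right))
  · apply Submodule.map_injective_of_injective F.subtype_injective
    simp only [Submodule.map_iSup, Submodule.map_subtype_top, hmap]
    exact hF.symm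

end Homogeneous

/-! ### Iterated brackets over finite sets -/

theorem negOnePow_sum {ι : Type*} (s : Finset ι) (d : ι → ℤ) :
    (∑ a ∈ s, d a).negOnePow = ∏ a ∈ s, (d a).negOnePow := by
  classical
  induction s using Finset.induction_on with
  | empty => simp
  | insert a s ha ih => rw [Finset.sum_insert ha, Finset.prod_insert ha, Int.negOnePow_add, ih]

section UnshuffleSign

variable {ι : Type*} [LinearOrder ι]

/-- The Koszul sign of sorting the concatenation of the increasing families with index sets `s`
and `t` and degrees `d`. -/
def unshuffleSign (d : ι → ℤ) (s t : Finset ι) : ℤˣ :=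
  ∏ a ∈ s, ∏ b ∈ t, if b < a then (d a * d b).negOnePow else 1

theorem unshuffleSign_insert_left (d : ι → ℤ) {s t : Finset ι} {m : ι} (hs : m ∉ s)
    (ht : ∀ b ∈ t, b < m) :
    unshuffleSign d (insert m s) t =
      unshuffleSign d s t * (d m * ∑ b ∈ t, d b).negOnePow := by
  rw [unshuffleSign, Finset.prod_insert hs, mul_comm, Finset.mul_sum, negOnePow_sum]
  exact congrArg _ (Finset.prod_congr rfl fun b hb => if_pos (ht b hb))

theorem unshuffleSign_insert_right (d : ι → ℤ) {s t : Finset ι} {m : ι} (hs : ∀ a ∈ s, a < m)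
    (ht : m ∉ t) : unshuffleSign d s (insert m t) = unshuffleSign d s t :=
  Finset.prod_congr rfl fun a ha => by
    rw [Finset.prod_insert ht, if_neg (hs a ha).not_gt, one_mul]

theorem unshuffleSign_mul_swap (d : ι → ℤ) {s t : Finset ι} (hst : Disjoint s t) :
    unshuffleSign d s t * unshuffleSign d t s =
      ((∑ a ∈ s, d a) * ∑ b ∈ t, d b).negOnePow := by
  simp only [unshuffleSign, Finset.sum_mul_sum, negOnePow_sum]
  rw [Finset.prod_comm (s := t), ← Finset.prod_mul_distrib]
  refine Finset.prod_congr rfl fun a ha => ?_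
  rw [← Finset.prod_mul_distrib]
  refine Finset.prod_congr rfl fun b hb => ?_
  rcases (Finset.disjoint_iff_ne.mp hst a ha b hb).lt_or_gt with h | h
  · rw [if_neg h.not_gt, if_pos h, one_mul, mul_comm]
  · rw [if_pos h, if_neg h.not_gt, mul_one]

end UnshuffleSign

section OrderedBracket

variable {ι K L : Type*} [LinearOrder ι] [Field K] [AddCommGroup L] [Module K L]

/-- The map `a ↦ [⋯[a, x_{k₁}], ⋯, x_{k_r}]`, where `k₁ < ⋯ < k_r` are the elements of `s`. -/
noncomputable def orderedBracket (br : L →ₗ[K] L →ₗ[K] L) (x : ι → L) (s : Finset ι) :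
    Module.End K L :=
  ((s.sort (· ≥ ·)).map fun k => br.flip (x k)).prod

variable (br : L →ₗ[K] L →ₗ[K] L) (x : ι → L)

@[simp]
theorem orderedBracket_empty (a : L) : orderedBracket br x ∅ a = a := by
  simp [orderedBracket]

theorem orderedBracket_insert {s : Finset ι} {m : ι} (h : ∀ k ∈ s, k < m) (a : L) :
    orderedBracket br x (insert m s) a = br (orderedBracket br x s a) (x m) := by
  rw [orderedBracket, Finset.sort_insert _ (fun k hk => (h k hk).le) fun hm => (h m hm).false]
  rfl

theorem iteratedBracket_succ (a : L) (k : ℕ) (y : Fin (k + 1) → L) :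
    iteratedBracket br a (k + 1) y =
      br (iteratedBracket br a k (Fin.init y)) (y (Fin.last k)) := rfl

theorem iteratedBracket_cons (a b : L) {k : ℕ} (y : Fin k → L) :
    iteratedBracket br a (k + 1) (Fin.cons b y) = iteratedBracket br (br a b) k y := by
  induction k with
  | zero => rfl
  | succ k ih =>
    have hinit : Fin.init (Fin.cons b y : Fin (k + 2) → L) = Fin.cons b (Fin.init y) :=
      funext fun j => by cases j using Fin.cases <;> rfl
    rw [iteratedBracket_succ, hinit, ih, ← Fin.succ_last, Fin.cons_succ, iteratedBracket_succ]

theorem iteratedBracket_comp {k : ℕ} {e : Fin k → ι} (he : StrictMono e) (a : L) :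
    iteratedBracket br a k (x ∘ e) = orderedBracket br x (Finset.univ.image e) a := by
  induction k with
  | zero => rw [Finset.univ_eq_empty, Finset.image_empty, orderedBracket_empty]; rfl
  | succ k ih =>
    have hinit : StrictMono (e ∘ Fin.castSucc) := he.comp Fin.strictMono_castSucc
    have hlt : ∀ v ∈ Finset.univ.image (e ∘ Fin.castSucc), v < e (Fin.last k) := by
      simp only [Finset.mem_image, Finset.mem_univ, true_and]
      rintro _ ⟨b, rfl⟩
      exact he b.castSucc_lt_last
    have himage : Finset.univ.image e =
        insert (e (Fin.last k)) (Finset.univ.image (e ∘ Fin.castSucc)) := by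
      rw [Fin.univ_castSuccEmb, Finset.cons_eq_insert, Finset.image_insert,
        Finset.map_eq_image, Finset.image_image]
      rfl
    rw [himage, orderedBracket_insert br x hlt, ← ih hinit]
    rfl

end OrderedBracket

namespace IsGradedLieAlgebra

variable {K L : Type*} [Field K] [AddCommGroup L] [Module K L]
  {𝓖 : ℤ → Submodule K L} {br : L →ₗ[K] L →ₗ[K] L}

theorem iSup_eq_top (h : IsGradedLieAlgebra 𝓖 br) : ⨆ k, 𝓖 k = ⊤ :=
  h.isInternal.submodule_iSup_eq_top

theorem bracket_bracket (h : IsGradedLieAlgebra 𝓖 br) (x : L) {b c : ℤ} {y z : L}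
    (hy : y ∈ 𝓖 b) (hz : z ∈ 𝓖 c) :
    br (br x y) z = br x (br y z) + (b * c).negOnePow • br (br x z) y := by
  have hx : x ∈ ⨆ k, 𝓖 k := h.iSup_eq_top ▸ Submodule.mem_top
  induction hx using Submodule.iSup_induction' with
  | mem a x hx =>
    have hsign : (a * b + b * (a + c)).negOnePow = (b * c).negOnePow :=
      (Int.negOnePow_eq_iff _ _).mpr ⟨a * b, by ring⟩
    rw [h.jacobi a b c x y z hx hy hz, h.antisymm b (a + c) y (br x z) hy
      (h.bracket_mem a c x z hx hz), smul_neg, smul_smul, ← Int.negOnePow_add, hsign, add_assoc,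
      neg_add_cancel, add_zero]
  | zero => simp
  | add x x' _ _ ih ih' =>
    simp only [map_add, LinearMap.add_apply, ih, ih', smul_add]
    abel

variable {ι : Type*} [LinearOrder ι] {x : ι → L} {d : ι → ℤ}

theorem orderedBracket_mem (h : IsGradedLieAlgebra 𝓖 br) (hx : ∀ k, x k ∈ 𝓖 (d k)) {α : ℤ}
    {a : L} (ha : a ∈ 𝓖 α) (s : Finset ι) :
    orderedBracket br x s a ∈ 𝓖 (α + ∑ k ∈ s, d k) := by
  induction s using Finset.induction_on_max with
  | empty => simpa using ha
  | insert m s hm ih =>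
    rw [orderedBracket_insert br x hm, Finset.sum_insert fun h => (hm m h).false,
      add_comm (d m), ← add_assoc]
    exact h.bracket_mem _ _ _ _ ih (hx m)

theorem orderedBracket_bracket (h : IsGradedLieAlgebra 𝓖 br) (hx : ∀ k, x k ∈ 𝓖 (d k)) (a : L)
    {β : ℤ} {b : L} (hb : b ∈ 𝓖 β) (s : Finset ι) :
    orderedBracket br x s (br a b) =
      ∑ t ∈ s.powerset, (unshuffleSign d t (s \ t) * (β * ∑ k ∈ t, d k).negOnePow) •
        br (orderedBracket br x t a) (orderedBracket br x (s \ t) b) := by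
  induction s using Finset.induction_on_max with
  | empty => simp [unshuffleSign]
  | insert m s hm ih =>
    have hms : m ∉ s := fun h => (hm m h).false
    rw [orderedBracket_insert br x hm, ih, Finset.sum_powerset_insert hms,
      ← Finset.sum_add_distrib, map_sum, LinearMap.sum_apply]
    refine Finset.sum_congr rfl fun t ht => ?_
    rw [Finset.mem_powerset] at ht
    have hmt : m ∉ t := fun h => hms (ht h)
    have hlt : ∀ k ∈ t, k < m := fun k hk => hm k (ht hk)
    have hlt' : ∀ k ∈ s \ t, k < m := fun k hk => hm k (Finset.sdiff_subset hk)
    rw [Finset.insert_sdiff_of_notMem s hmt, Finset.insert_sdiff_insert,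
      Finset.sdiff_insert_of_notMem hms, unshuffleSign_insert_right d hlt (by simp [hms]),
      unshuffleSign_insert_left d hmt hlt', orderedBracket_insert br x hlt,
      orderedBracket_insert br x hlt', Finset.sum_insert hmt, LinearMap.map_smul_of_tower,
      LinearMap.smul_apply, h.bracket_bracket _ (h.orderedBracket_mem hx hb _) (hx m), smul_add,
      smul_smul, mul_assoc, mul_assoc, ← Int.negOnePow_add, ← Int.negOnePow_add]
    congr 4
    ring

theorem bracket_orderedBracket (h : IsGradedLieAlgebra 𝓖 br) (hx : ∀ k, x k ∈ 𝓖 (d k)) (a : L)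
    {δ : ℤ} {y : L} (hy : y ∈ 𝓖 δ) (hxy : ∀ k, br (x k) y = 0) (s : Finset ι) :
    br (orderedBracket br x s a) y =
      (δ * ∑ k ∈ s, d k).negOnePow • orderedBracket br x s (br a y) := by
  induction s using Finset.induction_on_max with
  | empty => simp
  | insert m s hm ih =>
    rw [orderedBracket_insert br x hm, orderedBracket_insert br x hm,
      Finset.sum_insert fun h => (hm m h).false, h.bracket_bracket _ (hx m) hy, hxy, map_zero,
      zero_add, ih, LinearMap.map_smul_of_tower, LinearMap.smul_apply, smul_smul,
      ← Int.negOnePow_add]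
    congr 2
    ring

end IsGradedLieAlgebra

namespace IsCurvedVData

variable {K L : Type*} [Field K] [AddCommGroup L] [Module K L]
  {𝓖 : ℤ → Submodule K L} {br : L →ₗ[K] L →ₗ[K] L} {F : Submodule K L} {P : L →ₗ[K] L} {Δ : L}

theorem apply_mem (h : IsCurvedVData 𝓖 br F P Δ) (u : L) : P u ∈ F :=
  h.range_proj ▸ LinearMap.mem_range_self P u

theorem apply_mem_degree (h : IsCurvedVData 𝓖 br F P Δ) {k : ℤ} {u : L} (hu : u ∈ 𝓖 k) :
    P u ∈ 𝓖 k :=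
  apply_mem_of_range_of_ker h.gradedLie.isInternal.submodule_iSupIndep h.proj
    (h.range_proj ▸ h.subalgebra.homogeneous) h.ker_proj.homogeneous hu

theorem apply_bracket (h : IsCurvedVData 𝓖 br F P Δ) (u v : L) :
    P (br u v) = P (br (P u) v) + P (br u (P v)) := by
  have hker : ∀ w : L, w - P w ∈ LinearMap.ker P := fun w => by
    rw [LinearMap.mem_ker, map_sub, ← LinearMap.comp_apply, h.proj, sub_self]
  have hPP : br (P u) (P v) = 0 := h.abelian _ (h.apply_mem u) _ (h.apply_mem v)
  have hsub : P (br (u - P u) (v - P v)) = 0 := h.ker_proj.bracket_mem _ (hker u) _ (hker v)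
  simp only [map_sub, LinearMap.sub_apply, hPP, sub_zero] at hsub
  rw [← sub_eq_zero, ← hsub]
  abel

variable {ι : Type*} [LinearOrder ι] {x : ι → L} {d : ι → ℤ}

theorem bracket_orderedBracket_apply (h : IsCurvedVData 𝓖 br F P Δ)
    (hx : ∀ k, x k ∈ 𝓖 (d k)) (hxF : ∀ k, x k ∈ F) (s t : Finset ι) :
    br (orderedBracket br x t Δ) (P (orderedBracket br x s Δ)) =
      ((1 + ∑ k ∈ s, d k) * ∑ k ∈ t, d k).negOnePow •
        orderedBracket br x t (br Δ (P (orderedBracket br x s Δ))) :=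
  h.gradedLie.bracket_orderedBracket hx Δ
    (h.apply_mem_degree (h.gradedLie.orderedBracket_mem hx h.degree_one s))
    (fun k => h.abelian _ (hxF k) _ (h.apply_mem _)) t

theorem unshuffleSign_smul_apply_bracket (h : IsCurvedVData 𝓖 br F P Δ)
    (hx : ∀ k, x k ∈ 𝓖 (d k)) (hxF : ∀ k, x k ∈ F) {s t : Finset ι} (hst : Disjoint s t) :
    (unshuffleSign d s t * (1 * ∑ k ∈ s, d k).negOnePow) •
        P (br (orderedBracket br x s Δ) (orderedBracket br x t Δ)) =
      unshuffleSign d s t • P (orderedBracket br x t (br Δ (P (orderedBracket br x s Δ)))) +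
      unshuffleSign d t s • P (orderedBracket br x s (br Δ (P (orderedBracket br x t Δ)))) := by
  have hmem := fun s : Finset ι => h.gradedLie.orderedBracket_mem hx h.degree_one s
  have hswap : unshuffleSign d t s =
      unshuffleSign d s t * ((∑ k ∈ s, d k) * ∑ k ∈ t, d k).negOnePow := by
    rw [← unshuffleSign_mul_swap d hst, ← mul_assoc, Int.units_mul_self, one_mul]
  rw [h.apply_bracket, smul_add]
  congr 1
  · rw [h.gradedLie.antisymm _ _ _ _ (h.apply_mem_degree (hmem s)) (hmem t),
      h.bracket_orderedBracket_apply hx hxF, smul_smul, ← Int.negOnePow_add, map_neg,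
      LinearMap.map_smul_of_tower, ← Units.neg_smul, smul_smul, mul_assoc,
      ← Int.negOnePow_succ, ← Int.negOnePow_add, Int.negOnePow_even, mul_one]
    exact ⟨(1 + ∑ k ∈ s, d k) * (1 + ∑ k ∈ t, d k), by ring⟩
  · rw [h.bracket_orderedBracket_apply hx hxF, LinearMap.map_smul_of_tower, smul_smul, hswap,
      mul_assoc, ← Int.negOnePow_add]
    congr 2
    exact (Int.negOnePow_eq_iff _ _).mpr ⟨∑ k ∈ s, d k, by ring⟩

theorem sum_powerset_apply_eq_zero [NeZero (2 : K)] (h : IsCurvedVData 𝓖 br F P Δ)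
    (hx : ∀ k, x k ∈ 𝓖 (d k)) (hxF : ∀ k, x k ∈ F) (s : Finset ι) :
    ∑ t ∈ s.powerset, unshuffleSign d t (s \ t) •
      P (orderedBracket br x (s \ t) (br Δ (P (orderedBracket br x t Δ)))) = 0 := by
  set g : Finset ι → Finset ι → L := fun t t' => unshuffleSign d t t' •
    P (orderedBracket br x t' (br Δ (P (orderedBracket br x t Δ))))
  change ∑ t ∈ s.powerset, g t (s \ t) = 0
  have hsum : ∑ t ∈ s.powerset, (g t (s \ t) + g (s \ t) t) = 0 := by
    rw [← map_zero P, ← map_zero (orderedBracket br x s), ← h.square_zero,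
      h.gradedLie.orderedBracket_bracket hx Δ h.degree_one, map_sum]
    refine Finset.sum_congr rfl fun t _ => ?_
    rw [LinearMap.map_smul_of_tower,
      h.unshuffleSign_smul_apply_bracket hx hxF Finset.disjoint_sdiff]
  have hcompl : ∑ t ∈ s.powerset, g (s \ t) t = ∑ t ∈ s.powerset, g t (s \ t) :=
    Finset.sum_nbij' (s \ ·) (s \ ·) (by simp) (by simp)
      (fun t ht => Finset.sdiff_sdiff_eq_self (Finset.mem_powerset.mp ht))
      (fun t ht => Finset.sdiff_sdiff_eq_self (Finset.mem_powerset.mp ht))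
      fun t ht => by rw [Finset.sdiff_sdiff_eq_self (Finset.mem_powerset.mp ht)]
  rw [Finset.sum_add_distrib, hcompl, ← two_smul K] at hsum
  exact (smul_eq_zero.mp hsum).resolve_left two_ne_zero

end IsCurvedVData

/-! ### Koszul signs and shuffles -/

section KoszulSign

theorem prod_eq_prod_lt_mul_swap {ι M : Type*} [Fintype ι] [LinearOrder ι] [CommMonoid M]
    (f : ι × ι → M) (h : ∀ a, f (a, a) = 1) :
    ∏ p, f p = ∏ p : ι × ι, if p.1 < p.2 then f p * f p.swap else 1 := by
  have hswap : ∏ p : ι × ι, (if p.2 < p.1 then f p else 1) =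
      ∏ p : ι × ι, (if p.1 < p.2 then f p.swap else 1) :=
    Fintype.prod_equiv (Equiv.prodComm ι ι) _ _ fun p => by simp
  calc ∏ p, f p
      = ∏ p : ι × ι, (if p.1 < p.2 then f p else 1) * (if p.2 < p.1 then f p else 1) := by
        refine Finset.prod_congr rfl fun ⟨a, b⟩ _ => ?_
        rcases lt_trichotomy a b with hab | rfl | hab
        · simp [hab, hab.not_gt]
        · simp [h]
        · simp [hab, hab.not_gt]
    _ = _ := by
        rw [Finset.prod_mul_distrib, hswap, ← Finset.prod_mul_distrib]
        refine Finset.prod_congr rfl fun p _ => ?_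
        split_ifs <;> simp

variable {n : ℕ}

theorem koszulSign_one (d : Fin n → ℤ) : koszulSign d 1 = 1 :=
  Finset.prod_eq_one fun _ _ => if_neg fun h => h.1.not_gt h.2

theorem koszulSign_mul (d : Fin n → ℤ) (σ τ : Equiv.Perm (Fin n)) :
    koszulSign d (σ * τ) = koszulSign d σ * koszulSign (d ∘ σ) τ := by
  have hσ : koszulSign d σ = ∏ p : Fin n × Fin n, if τ p.1 < τ p.2 ∧ σ (τ p.2) < σ (τ p.1) then
      (d (σ (τ p.1)) * d (σ (τ p.2))).negOnePow else 1 :=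
    (Fintype.prod_equiv (Equiv.prodCongr τ τ) _ _ fun p => by simp).symm
  rw [hσ, prod_eq_prod_lt_mul_swap _ (by simp), koszulSign, koszulSign,
    ← Finset.prod_mul_distrib]
  refine Finset.prod_congr rfl fun ⟨a, b⟩ _ => ?_
  simp only [Equiv.Perm.mul_apply, Prod.fst_swap, Prod.snd_swap, Function.comp_apply]
  by_cases hab : a < b
  · have hτ : τ a ≠ τ b := τ.injective.ne hab.ne
    simp only [hab, true_and, if_true]
    rcases hτ.lt_or_gt with h | h <;> rcases (σ.injective.ne hτ).lt_or_gt with h' | h' <;>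
      simp [h, h', h.not_gt, h'.not_gt, mul_comm (d (σ (τ b)))]
  · simp [hab]

theorem koszulSign_swap (d : Fin (n + 1) → ℤ) (i : Fin n) :
    koszulSign d (Equiv.swap i.castSucc i.succ) = (d i.castSucc * d i.succ).negOnePow := by
  rw [koszulSign, Finset.prod_eq_single (i.castSucc, i.succ)]
  · simp [mul_comm]
  · rintro ⟨a, b⟩ - hab
    refine if_neg fun ⟨hlt, hinv⟩ => hab ?_
    simp only [Equiv.swap_apply_def, Fin.ext_iff, Fin.lt_def, Prod.mk.injEq, Fin.val_castSucc,
      Fin.val_succ] at hlt hinv ⊢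
    split_ifs at hinv <;> (try simp only [Fin.val_castSucc, Fin.val_succ] at hinv) <;> omega
  · simp

end KoszulSign

section Shuffles

variable {n i : ℕ} {σ τ : Equiv.Perm (Fin n)}

/-- The set of values of `σ` on the first `i` positions. -/
def firstBlock (i : ℕ) (σ : Equiv.Perm (Fin n)) : Finset (Fin n) :=
  Finset.univ.filter fun v => (σ.symm v : ℕ) < i

theorem apply_mem_firstBlock {a : Fin n} : σ a ∈ firstBlock i σ ↔ (a : ℕ) < i := by
  simp [firstBlock]

theorem firstBlock_eq_image (hi : i ≤ n) (σ : Equiv.Perm (Fin n)) :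
    firstBlock i σ = Finset.univ.image fun a : Fin i => σ (a.castLE hi) := by
  ext v
  obtain ⟨a, rfl⟩ := σ.surjective v
  simp only [apply_mem_firstBlock, Finset.mem_image, Finset.mem_univ, true_and,
    EmbeddingLike.apply_eq_iff_eq]
  exact ⟨fun ha => ⟨⟨a, ha⟩, rfl⟩, fun ⟨b, hb⟩ => hb ▸ b.2⟩

theorem compl_firstBlock_eq_image (i : ℕ) (σ : Equiv.Perm (Fin n)) :
    (firstBlock i σ)ᶜ = Finset.univ.image fun b : Fin (n - i) => σ ⟨i + b, by omega⟩ := by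
  ext v
  obtain ⟨a, rfl⟩ := σ.surjective v
  simp only [Finset.mem_compl, apply_mem_firstBlock, not_lt, Finset.mem_image, Finset.mem_univ,
    true_and, EmbeddingLike.apply_eq_iff_eq]
  exact ⟨fun ha => ⟨⟨a - i, by omega⟩, Fin.ext (Nat.add_sub_cancel' ha)⟩,
    fun ⟨b, hb⟩ => hb ▸ Nat.le_add_right i b⟩

theorem card_firstBlock (hi : i ≤ n) (σ : Equiv.Perm (Fin n)) : (firstBlock i σ).card = i := by
  rw [firstBlock_eq_image hi]
  exact (Finset.card_image_of_injective _ (σ.injective.comp (Fin.castLE_injective hi))).trans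
    (Finset.card_fin i)

theorem mem_shuffles : σ ∈ shuffles n i ↔ IsShuffle i σ := by
  simp [shuffles]

namespace IsShuffle

theorem strictMono_left (h : IsShuffle i σ) (hi : i ≤ n) :
    StrictMono fun a : Fin i => σ (a.castLE hi) := fun _ b hab =>
  h _ _ hab (Or.inl b.2)

theorem strictMono_right (h : IsShuffle i σ) :
    StrictMono fun b : Fin (n - i) => σ ⟨i + b, by omega⟩ := fun _ _ hab =>
  h _ _ (Nat.add_lt_add_left hab i) (Or.inr (Nat.le_add_right _ _))

theorem koszulSign_eq (h : IsShuffle i σ) (d : Fin n → ℤ) :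
    koszulSign d σ = unshuffleSign d (firstBlock i σ) (firstBlock i σ)ᶜ := by
  have hreindex : koszulSign d σ = ∏ p : Fin n × Fin n,
      if p ∈ firstBlock i σ ×ˢ (firstBlock i σ)ᶜ then
        if p.2 < p.1 then (d p.1 * d p.2).negOnePow else 1 else 1 := by
    refine Fintype.prod_equiv (Equiv.prodCongr σ σ) _ _ fun ⟨a, b⟩ => ?_
    simp only [Equiv.prodCongr_apply, Prod.map_apply, Finset.mem_product, Finset.mem_compl,
      apply_mem_firstBlock, ← ite_and]
    refine if_congr ⟨fun ⟨hab, hinv⟩ => ⟨?_, hinv⟩, fun ⟨_, hinv⟩ => ⟨?_, hinv⟩⟩ rfl rfl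
    · have := mt (h a b hab) hinv.not_gt
      omega
    · exact Fin.lt_def.mpr (by omega)
  rw [hreindex, Finset.prod_ite_mem, Finset.univ_inter, Finset.prod_product, unshuffleSign]

theorem eq_of_firstBlock_eq (hσ : IsShuffle i σ) (hτ : IsShuffle i τ) (hi : i ≤ n)
    (h : firstBlock i σ = firstBlock i τ) : σ = τ := by
  have hleft : (fun a : Fin i => σ (a.castLE hi)) = fun a => τ (a.castLE hi) := by
    rw [← (hσ.strictMono_left hi).range_inj (hτ.strictMono_left hi), ← Fintype.coe_image_univ,
      ← Fintype.coe_image_univ, ← firstBlock_eq_image, ← firstBlock_eq_image, h]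
  have hright : (fun b : Fin (n - i) => σ ⟨i + b, by omega⟩) =
      fun b : Fin (n - i) => τ ⟨i + b, by omega⟩ := by
    rw [← hσ.strictMono_right.range_inj hτ.strictMono_right, ← Fintype.coe_image_univ,
      ← Fintype.coe_image_univ, ← compl_firstBlock_eq_image, ← compl_firstBlock_eq_image, h]
  refine Equiv.ext fun a => ?_
  by_cases ha : (a : ℕ) < i
  · exact congrFun hleft ⟨a, ha⟩
  · have heq : (⟨i + (a - i), by omega⟩ : Fin n) = a := Fin.ext (by simp only; omega)
    simpa only [heq] using congrFun hright ⟨a - i, by omega⟩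

end IsShuffle

theorem exists_isShuffle_firstBlock_eq (S : Finset (Fin n)) :
    ∃ σ : Equiv.Perm (Fin n), IsShuffle S.card σ ∧ firstBlock S.card σ = S := by
  have hS : S.card ≤ n := card_finset_fin_le S
  have hSc : Sᶜ.card = n - S.card := by rw [Finset.card_compl, Fintype.card_fin]
  let σ : Equiv.Perm (Fin n) :=
    ((finCongr (Nat.add_sub_cancel' hS).symm).trans finSumFinEquiv.symm).trans
      (finSumEquivOfFinset rfl hSc)
  have hleft : ∀ (a : Fin n) (ha : (a : ℕ) < S.card), σ a = S.orderEmbOfFin rfl ⟨a, ha⟩ := by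
    intro a ha
    have hcast : finCongr (Nat.add_sub_cancel' hS).symm a =
      Fin.castAdd (n - S.card) ⟨a, ha⟩ := rfl
    simp only [σ, Equiv.trans_apply, hcast, finSumFinEquiv_symm_apply_castAdd,
      finSumEquivOfFinset_inl]
  have hright : ∀ (a : Fin n) (_ : S.card ≤ (a : ℕ)),
      σ a = Sᶜ.orderEmbOfFin hSc ⟨a - S.card, by omega⟩ := by
    intro a ha
    have hcast : finCongr (Nat.add_sub_cancel' hS).symm a =
      Fin.natAdd S.card ⟨a - S.card, by omega⟩ := Fin.ext (Nat.add_sub_cancel' ha).symm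
    simp only [σ, Equiv.trans_apply, hcast, finSumFinEquiv_symm_apply_natAdd,
      finSumEquivOfFinset_inr]
  refine ⟨σ, fun a b hab h => ?_, Finset.eq_of_subset_of_card_le (fun v hv => ?_) ?_⟩
  · rcases h with hb | ha
    · rw [hleft a (Nat.lt_trans hab hb), hleft b hb, OrderEmbedding.lt_iff_lt]
      exact hab
    · rw [hright a ha, hright b (ha.trans hab.le), OrderEmbedding.lt_iff_lt]
      exact Fin.lt_def.mpr (Nat.sub_lt_sub_right ha hab)
  · obtain ⟨a, rfl⟩ := σ.surjective v
    rw [hleft a (apply_mem_firstBlock.mp hv)]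
    exact S.orderEmbOfFin_mem rfl _
  · rw [card_firstBlock hS]

theorem sum_shuffles {M : Type*} [AddCommMonoid M] (hi : i ≤ n) (g : Finset (Fin n) → M) :
    ∑ σ ∈ shuffles n i, g (firstBlock i σ) = ∑ S ∈ Finset.univ.powersetCard i, g S := by
  refine Finset.sum_bij (fun σ _ => firstBlock i σ)
    (fun σ _ => Finset.mem_powersetCard.mpr ⟨Finset.subset_univ _, card_firstBlock hi σ⟩)
    (fun σ hσ τ hτ h => (mem_shuffles.mp hσ).eq_of_firstBlock_eq (mem_shuffles.mp hτ) hi h)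
    (fun S hS => ?_) fun _ _ => rfl
  obtain ⟨-, rfl⟩ := Finset.mem_powersetCard.mp hS
  obtain ⟨σ, hσ, h⟩ := exists_isShuffle_firstBlock_eq S
  exact ⟨σ, mem_shuffles.mpr hσ, h⟩

theorem sum_sum_shuffles {M : Type*} [AddCommMonoid M] (g : Finset (Fin n) → M) :
    ∑ i : Fin (n + 1), ∑ σ ∈ shuffles n i, g (firstBlock i σ) =
      ∑ S ∈ Finset.univ.powerset, g S := by
  rw [Finset.sum_powerset, Finset.card_univ, Fintype.card_fin, Finset.sum_range]
  exact Finset.sum_congr rfl fun i _ => sum_shuffles (Nat.lt_succ_iff.mp i.2) g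

end Shuffles

namespace IsGradedLieAlgebra

variable {K L : Type*} [Field K] [AddCommGroup L] [Module K L]
  {𝓖 : ℤ → Submodule K L} {br : L →ₗ[K] L →ₗ[K] L}

theorem iteratedBracket_swap (h : IsGradedLieAlgebra 𝓖 br) (a : L) {n : ℕ}
    {d : Fin (n + 1) → ℤ} {x : Fin (n + 1) → L} (hx : ∀ k, x k ∈ 𝓖 (d k))
    (hxx : ∀ j k, br (x j) (x k) = 0) (i : Fin n) :
    iteratedBracket br a (n + 1) (x ∘ Equiv.swap i.castSucc i.succ) =
      (d i.castSucc * d i.succ).negOnePow • iteratedBracket br a (n + 1) x := by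
  induction n with
  | zero => exact i.elim0
  | succ n ih =>
    cases i using Fin.lastCases with
    | last =>
      have hinit : Fin.init (Fin.init (x ∘ Equiv.swap (Fin.last n).castSucc (Fin.last n).succ)) =
          Fin.init (Fin.init x) := funext fun j => congrArg x <|
        Equiv.swap_apply_of_ne_of_ne (by simp [Fin.ext_iff, j.2.ne])
          (by simp [Fin.ext_iff]; omega)
      rw [iteratedBracket_succ, iteratedBracket_succ, hinit, iteratedBracket_succ,
        iteratedBracket_succ, Fin.init, Function.comp_apply, Function.comp_apply,
        Equiv.swap_apply_left, ← Fin.succ_last, Equiv.swap_apply_right,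
        h.bracket_bracket _ (hx _) (hx _), hxx, map_zero, zero_add, mul_comm]
      rfl
    | cast j =>
      have hinit : Fin.init (x ∘ Equiv.swap j.castSucc.castSucc j.castSucc.succ) =
          Fin.init x ∘ Equiv.swap j.castSucc j.succ := funext fun k => congrArg x <|
        (Fin.castSucc_injective _).swap_apply j.castSucc j.succ k
      have hlast : Equiv.swap j.castSucc.castSucc j.castSucc.succ (Fin.last (n + 1)) =
          Fin.last (n + 1) :=
        Equiv.swap_apply_of_ne_of_ne (by simp [Fin.ext_iff]; omega)
          (by simp [Fin.ext_iff, j.2.ne'])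
      rw [iteratedBracket_succ, hinit,
        ih (d := Fin.init d) (x := Fin.init x) (fun _ => hx _) (fun _ _ => hxx _ _),
        Function.comp_apply, hlast, LinearMap.map_smul_of_tower, LinearMap.smul_apply]
      rfl

theorem iteratedBracket_perm (h : IsGradedLieAlgebra 𝓖 br) (a : L) {n : ℕ}
    {d : Fin n → ℤ} {x : Fin n → L} (hx : ∀ k, x k ∈ 𝓖 (d k))
    (hxx : ∀ j k, br (x j) (x k) = 0) (σ : Equiv.Perm (Fin n)) :
    iteratedBracket br a n (x ∘ σ) = koszulSign d σ • iteratedBracket br a n x := by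
  cases n with
  | zero => rw [Subsingleton.elim σ 1, koszulSign_one, one_smul, Equiv.Perm.coe_one,
      Function.comp_id]
  | succ n =>
    have hσ : σ ∈ Submonoid.closure
        (Set.range fun i : Fin n ↦ Equiv.swap i.castSucc i.succ) :=
      Equiv.Perm.mclosure_swap_castSucc_succ n ▸ Submonoid.mem_top σ
    induction hσ using Submonoid.closure_induction generalizing d x with
    | mem σ hσ =>
      obtain ⟨i, rfl⟩ := hσ
      rw [koszulSign_swap, h.iteratedBracket_swap a hx hxx]
    | one => rw [koszulSign_one, one_smul, Equiv.Perm.coe_one, Function.comp_id]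
    | mul σ τ _ _ hσ hτ =>
      rw [koszulSign_mul, mul_comm, mul_smul, ← hσ hx hxx]
      exact hτ (fun k => hx (σ k)) fun j k => hxx _ _

theorem iteratedBracket_mem (h : IsGradedLieAlgebra 𝓖 br) {α : ℤ} {a : L} (ha : a ∈ 𝓖 α) {n : ℕ}
    {d : Fin n → ℤ} {x : Fin n → L} (hx : ∀ k, x k ∈ 𝓖 (d k)) :
    iteratedBracket br a n x ∈ 𝓖 (α + ∑ k, d k) := by
  rw [← Function.comp_id x, iteratedBracket_comp br x strictMono_id, Finset.image_id]
  exact h.orderedBracket_mem hx ha Finset.univ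

end IsGradedLieAlgebra

namespace IsCurvedVData

variable {K L : Type*} [Field K] [AddCommGroup L] [Module K L]
  {𝓖 : ℤ → Submodule K L} {br : L →ₗ[K] L →ₗ[K] L} {F : Submodule K L} {P : L →ₗ[K] L} {Δ : L}

theorem sum_shuffles_apply_eq_zero [NeZero (2 : K)] (h : IsCurvedVData 𝓖 br F P Δ) {n : ℕ}
    {d : Fin n → ℤ} {x : Fin n → L} (hx : ∀ k, x k ∈ 𝓖 (d k)) (hxF : ∀ k, x k ∈ F) :
    ∑ i : Fin (n + 1), ∑ σ ∈ shuffles n i, koszulSign d σ •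
      P (iteratedBracket br Δ (n - i + 1) (Fin.cons
        (P (iteratedBracket br Δ i fun a : Fin i => x (σ ⟨a, by omega⟩)))
        fun b : Fin (n - i) => x (σ ⟨i + b, by omega⟩))) = 0 := by
  rw [← h.sum_powerset_apply_eq_zero hx hxF Finset.univ, ← sum_sum_shuffles]
  refine Finset.sum_congr rfl fun i _ => Finset.sum_congr rfl fun σ hσ => ?_
  have hi : (i : ℕ) ≤ n := Nat.lt_succ_iff.mp i.2
  rw [mem_shuffles] at hσ
  rw [hσ.koszulSign_eq, ← Finset.compl_eq_univ_sdiff, iteratedBracket_cons,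
    compl_firstBlock_eq_image, ← iteratedBracket_comp br x hσ.strictMono_right,
    firstBlock_eq_image hi, ← iteratedBracket_comp br x (hσ.strictMono_left hi)]
  rfl

theorem isCurvedLInfinity [NeZero (2 : K)] (h : IsCurvedVData 𝓖 br F P Δ) :
    IsCurvedLInfinity (V := F) (inducedGrading 𝓖 F) (derivedBracket br F P h.apply_mem Δ) where
  isInternal := isInternal_inducedGrading h.gradedLie.isInternal h.subalgebra.homogeneous
  degree_one n d x hx := by
    rw [add_comm]
    exact h.apply_mem_degree (h.gradedLie.iteratedBracket_mem h.degree_one hx)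
  graded_symm n d x hx σ := by
    have hperm := h.gradedLie.iteratedBracket_perm Δ (x := fun k => (x k : L)) hx
      (fun j k => h.abelian _ (x j).2 _ (x k).2) σ
    exact Subtype.ext <| (congrArg P hperm).trans (P.map_smul_of_tower _ _)
  jacobi n d x hx := by
    refine Subtype.ext (Eq.trans ?_ (h.sum_shuffles_apply_eq_zero hx fun k => (x k).2))
    rw [← F.subtype_apply, map_sum]
    refine Finset.sum_congr rfl fun i _ => ?_
    rw [map_sum]
    refine Finset.sum_congr rfl fun σ _ => ?_
    refine congrArg (fun y => koszulSign d σ • P (iteratedBracket br Δ (n - i + 1) y))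
      (funext fun b => ?_)
    cases b using Fin.cases <;> rfl

end IsCurvedVData

/-! ### The Gerstenhaber bracket -/

namespace CochainSum

variable {K V W V' W' M : Type*} [Field K] [AddCommGroup V] [Module K V] [AddCommGroup W]
  [Module K W] [AddCommGroup V'] [Module K V'] [AddCommGroup W'] [Module K W'] [AddCommGroup M]
  [Module K M]

theorem hom_ext₂ {φ ψ : CochainSum K V W →ₗ[K] CochainSum K V' W' →ₗ[K] M}
    (h : ∀ (m : ℕ) (f : Cochain K V W m) (n : ℕ) (g : Cochain K V' W' n),
      φ (of m f) (of n g) = ψ (of m f) (of n g)) : φ = ψ :=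
  hom_ext fun m f => hom_ext (h m f)

/-- The projection of `⊕_{n ≥ 0} Hom(⊗^{n+1} V, W)` onto `Hom(⊗^{n+1} V, W)`. -/
noncomputable def coeff (n : ℕ) : CochainSum K V W →ₗ[K] Cochain K V W n :=
  DirectSum.component K ℕ (Cochain K V W) n

theorem ext_coeff {x y : CochainSum K V W} (h : ∀ n, coeff n x = coeff n y) : x = y :=
  DirectSum.ext_component K h

@[simp]
theorem coeff_of_self (n : ℕ) (f : Cochain K V W n) : coeff n (of n f) = f :=
  DirectSum.component.lof_self K n f

theorem coeff_of_of_ne {m n : ℕ} (h : m ≠ n) (f : Cochain K V W m) : coeff n (of m f) = 0 :=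
  (DirectSum.component.of K n m f).trans (dif_neg h)

theorem coeff_desc_of_comp (φ : (n : ℕ) → Cochain K V W n →ₗ[K] Cochain K V' W' n) (n : ℕ)
    (x : CochainSum K V W) :
    coeff n (desc (fun k => of k ∘ₗ φ k) x) = φ n (coeff n x) := by
  suffices h : coeff n ∘ₗ desc (fun k => of k ∘ₗ φ k) = φ n ∘ₗ coeff n from
    LinearMap.congr_fun h x
  refine hom_ext fun m f => ?_
  rw [LinearMap.comp_apply, LinearMap.comp_apply, desc_of, LinearMap.comp_apply]
  obtain rfl | h := eq_or_ne m n
  · rw [coeff_of_self, coeff_of_self]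
  · rw [coeff_of_of_ne h, coeff_of_of_ne h, map_zero]

end CochainSum

section CochainGrading

variable {K V W : Type*} [Field K] [AddCommGroup V] [Module K V] [AddCommGroup W] [Module K W]

theorem of_mem_cochainGrading {n : ℕ} (f : Cochain K V W n) :
    CochainSum.of n f ∈ cochainGrading K V W n := ⟨f, rfl⟩

theorem eq_zero_or_exists_of_mem_cochainGrading {a : ℤ} {x : CochainSum K V W}
    (hx : x ∈ cochainGrading K V W a) :
    x = 0 ∨ ∃ (n : ℕ) (f : Cochain K V W n), a = n ∧ x = CochainSum.of n f := by
  cases a with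
  | ofNat n =>
    obtain ⟨f, rfl⟩ := hx
    exact Or.inr ⟨n, f, rfl, rfl⟩
  | negSucc n => exact Or.inl ((Submodule.mem_bot K).mp hx)

theorem iSupIndep_cochainGrading : iSupIndep (cochainGrading K V W) := by
  intro a
  rw [Submodule.disjoint_def]
  intro x hx hx'
  rcases eq_zero_or_exists_of_mem_cochainGrading hx with rfl | ⟨n, f, rfl, rfl⟩
  · rfl
  have hle : (⨆ j, ⨆ _ : j ≠ (n : ℤ), cochainGrading K V W j) ≤
      LinearMap.ker (CochainSum.coeff n) := by
    refine iSup₂_le fun j hj y hy => ?_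
    rcases eq_zero_or_exists_of_mem_cochainGrading hy with rfl | ⟨k, g, rfl, rfl⟩
    · exact zero_mem _
    · exact CochainSum.coeff_of_of_ne (by exact_mod_cast hj) g
  have hf : f = 0 := (CochainSum.coeff_of_self n f).symm.trans (hle hx')
  rw [hf, map_zero]

theorem iSup_cochainGrading : ⨆ k, cochainGrading K V W k = ⊤ := by
  rw [← Submodule.ker_mkQ (⨆ k, cochainGrading K V W k), LinearMap.ker_eq_top]
  exact CochainSum.hom_ext fun n f => (Submodule.Quotient.mk_eq_zero _).mpr
    (Submodule.mem_iSup_of_mem (n : ℤ) (of_mem_cochainGrading f))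

theorem isInternal_cochainGrading : DirectSum.IsInternal (cochainGrading K V W) :=
  (DirectSum.isInternal_submodule_iff_iSupIndep_and_iSup_eq_top _).mpr
    ⟨iSupIndep_cochainGrading, iSup_cochainGrading⟩

end CochainGrading

section SequenceEvaluation

variable {K V W : Type*} [Field K] [AddCommGroup V] [Module K V] [AddCommGroup W] [Module K W]

/-- Evaluation of cochains of degree `n` at the first `n + 1` terms of a sequence. Infinite
sequences serve cochains of all degrees at once, so that no casts between the types `Fin (n + 1)`
are needed. -/
def evalSeq {n : ℕ} (x : ℕ → V) : Cochain K V W n →ₗ[K] W where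
  toFun f := f fun i => x i
  map_add' _ _ := rfl
  map_smul' _ _ := rfl

theorem ext_evalSeq {n : ℕ} {f g : Cochain K V W n} (h : ∀ x, evalSeq x f = evalSeq x g) :
    f = g := by
  refine MultilinearMap.ext fun y => ?_
  have hy : y = fun i : Fin (n + 1) => Function.extend Fin.val y 0 i :=
    funext fun i => (Fin.val_injective.extend_apply y 0 i).symm
  rw [hy]
  exact h _

theorem evalSeq_congr {n : ℕ} (f : Cochain K V W n) {x y : ℕ → V} (h : ∀ k ≤ n, x k = y k) :
    evalSeq x f = evalSeq y f :=
  congrArg f (funext fun i => h i (Nat.lt_succ_iff.mp i.2))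

theorem evalSeq_coeff_of {m : ℕ} (n : ℕ) (x : ℕ → V) (f : Cochain K V W m) :
    evalSeq x (CochainSum.coeff n (CochainSum.of m f)) = if m = n then evalSeq x f else 0 := by
  split_ifs with h
  · subst h
    rw [CochainSum.coeff_of_self]
  · rw [CochainSum.coeff_of_of_ne h, map_zero]

/-- The sequence `(x₀, …, x_{i-1}, v, x_{i+n+1}, …)`. -/
def insertSeq {V : Type*} (i n : ℕ) (x : ℕ → V) (v : V) (j : ℕ) : V :=
  if j < i then x j else if j = i then v else x (j + n)

theorem insertSeq_nested {V : Type*} {i n k : ℕ} (hk : k ≤ n) (p : ℕ) (x : ℕ → V) (v w : V) :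
    insertSeq i n (insertSeq (i + k) p x v) w = insertSeq i (n + p) x w := by
  funext j
  simp only [insertSeq]
  split_ifs <;> first | rfl | omega | exact congrArg x (by omega)

theorem insertSeq_shift {V : Type*} (i k p : ℕ) (x : ℕ → V) (v : V) :
    (fun j => insertSeq (i + k) p x v (i + j)) = insertSeq k p (fun j => x (i + j)) v := by
  funext j
  simp only [insertSeq]
  split_ifs <;> first | rfl | omega | exact congrArg x (by omega)

theorem insertSeq_comm {V : Type*} {i j : ℕ} (h : i < j) (n p : ℕ) (x : ℕ → V) (v w : V) :
    insertSeq i n (insertSeq (j + n) p x v) w = insertSeq j p (insertSeq i n x w) v := by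
  funext k
  simp only [insertSeq]
  split_ifs <;> first | rfl | omega | exact congrArg x (by omega)

theorem insertSeq_add_of_lt {V : Type*} {i j : ℕ} (h : j < i) (p k : ℕ) (x : ℕ → V) (v : V) :
    insertSeq j p x v (i + k) = x (i + p + k) := by
  simp only [insertSeq]
  split_ifs <;> first | omega | exact congrArg x (by omega)

theorem evalSeq_insertSeq {m i : ℕ} (hi : i ≤ m) (f : Cochain K V W m) (n : ℕ) (x : ℕ → V)
    (v : V) :
    evalSeq (insertSeq i n x v) f =
      f.toLinearMap (fun j => insertSeq i n x 0 j) ⟨i, Nat.lt_succ_iff.mpr hi⟩ v := by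
  rw [MultilinearMap.toLinearMap_apply]
  refine congrArg f (funext fun j => ?_)
  simp only [insertSeq, Function.update_apply, Fin.ext_iff]
  split_ifs <;> first | rfl | omega

end SequenceEvaluation

section PreLie

variable {K V : Type*} [Field K] [AddCommGroup V] [Module K V] {m n p : ℕ}

theorem evalSeq_partialComp (i : Fin (m + 1)) (f : Cochain K V V m) (g : Cochain K V V n)
    (x : ℕ → V) :
    evalSeq x (partialComp i f g) =
      evalSeq (insertSeq i n x (evalSeq (fun k => x (i + k)) g)) f := by
  refine congrArg f (funext fun j => ?_)
  simp only [insertArgs, insertSeq, Fin.lt_def, Fin.ext_iff]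
  rfl

theorem circ_eq_sum_partialComp (f : Cochain K V V m) (g : Cochain K V V n) :
    circ m n f g = ∑ i : Fin (m + 1), (-1 : K) ^ ((i : ℕ) * n) • partialComp i f g := by
  simp only [circ, LinearMap.sum_apply, LinearMap.smul_apply]
  rfl

theorem evalSeq_circ (f : Cochain K V V m) (g : Cochain K V V n) (x : ℕ → V) :
    evalSeq x (circ m n f g) = ∑ i ∈ Finset.range (m + 1), (-1 : K) ^ (i * n) •
      evalSeq (insertSeq i n x (evalSeq (fun k => x (i + k)) g)) f := by
  simp only [circ_eq_sum_partialComp, map_sum, map_smul, evalSeq_partialComp, Finset.sum_range]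

/-- The term of `(f ∘ g) ∘ h` in which `g` is inserted into the `i`-th argument of `f` and `h`
into the `j`-th argument of the result, with its sign. -/
def doubleInsertion (f : Cochain K V V m) (g : Cochain K V V n) (h : Cochain K V V p)
    (x : ℕ → V) (i j : ℕ) : V :=
  let y := insertSeq j p x (evalSeq (fun k => x (j + k)) h)
  (-1 : K) ^ (i * n + j * p) • evalSeq (insertSeq i n y (evalSeq (fun k => y (i + k)) g)) f

theorem evalSeq_circ_circ_left (f : Cochain K V V m) (g : Cochain K V V n) (h : Cochain K V V p)
    (x : ℕ → V) :
    evalSeq x (circ (m + n) p (circ m n f g) h) =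
      ∑ i ∈ Finset.range (m + 1), ∑ j ∈ Finset.range (m + n + 1), doubleInsertion f g h x i j := by
  rw [evalSeq_circ, Finset.sum_comm]
  refine Finset.sum_congr rfl fun j _ => ?_
  rw [evalSeq_circ, Finset.smul_sum]
  refine Finset.sum_congr rfl fun i _ => ?_
  rw [doubleInsertion, smul_smul, ← pow_add, add_comm]

theorem sum_doubleInsertion_add (f : Cochain K V V m) (g : Cochain K V V n) (h : Cochain K V V p)
    (x : ℕ → V) {i : ℕ} (hi : i ≤ m) :
    ∑ k ∈ Finset.range (n + 1), doubleInsertion f g h x i (i + k) =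
      (-1 : K) ^ (i * (n + p)) •
        evalSeq (insertSeq i (n + p) x (evalSeq (fun k => x (i + k)) (circ n p g h))) f := by
  rw [evalSeq_circ, evalSeq_insertSeq hi, map_sum, Finset.smul_sum]
  refine Finset.sum_congr rfl fun k hk => ?_
  rw [map_smul, ← evalSeq_insertSeq hi, smul_smul, ← pow_add]
  simp only [doubleInsertion, insertSeq_shift,
    insertSeq_nested (Nat.lt_succ_iff.mp (Finset.mem_range.mp hk)), add_assoc]
  congr 2
  ring

theorem doubleInsertion_add_of_lt (f : Cochain K V V m) (g : Cochain K V V n)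
    (h : Cochain K V V p) (x : ℕ → V) {i j : ℕ} (hij : i < j) :
    doubleInsertion f g h x i (j + n) = (-1 : K) ^ (n * p) • doubleInsertion f h g x j i := by
  have hg : evalSeq (fun k => insertSeq (j + n) p x (evalSeq (fun k => x (j + n + k)) h) (i + k))
      g = evalSeq (fun k => x (i + k)) g :=
    evalSeq_congr g fun k hk => if_pos (by omega)
  simp only [doubleInsertion, hg, insertSeq_comm hij, insertSeq_add_of_lt hij, smul_smul,
    ← pow_add]
  congr 2
  ring

/-- The sum of the terms of `(f ∘ g) ∘ h` in which `h` is inserted to the left of `g`. -/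
def disjointInsertions (f : Cochain K V V m) (g : Cochain K V V n) (h : Cochain K V V p)
    (x : ℕ → V) : V :=
  ∑ i ∈ Finset.range (m + 1), ∑ j ∈ Finset.range i, doubleInsertion f g h x i j

theorem sum_sum_doubleInsertion_add_of_lt (f : Cochain K V V m) (g : Cochain K V V n)
    (h : Cochain K V V p) (x : ℕ → V) :
    ∑ i ∈ Finset.range (m + 1), ∑ j ∈ Finset.Ico (i + 1) (m + 1),
      doubleInsertion f g h x i (j + n) = (-1 : K) ^ (n * p) • disjointInsertions f h g x := by
  rw [disjointInsertions, Finset.smul_sum, Finset.sum_comm' (t' := Finset.range (m + 1))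
    (s' := fun j => Finset.range j)]
  · refine Finset.sum_congr rfl fun j _ => ?_
    rw [Finset.smul_sum]
    exact Finset.sum_congr rfl fun i hi =>
      doubleInsertion_add_of_lt f g h x (Finset.mem_range.mp hi)
  · intro i j
    simp only [Finset.mem_range, Finset.mem_Ico]
    omega

theorem evalSeq_circ_circ (f : Cochain K V V m) (g : Cochain K V V n) (h : Cochain K V V p)
    (x : ℕ → V) :
    evalSeq x (circ (m + n) p (circ m n f g) h) =
      evalSeq x (circ m (n + p) f (circ n p g h)) +
        (disjointInsertions f g h x + (-1 : K) ^ (n * p) • disjointInsertions f h g x) := by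
  have hsplit : ∀ i ∈ Finset.range (m + 1),
      ∑ j ∈ Finset.range (m + n + 1), doubleInsertion f g h x i j =
        ∑ j ∈ Finset.range i, doubleInsertion f g h x i j +
          (-1 : K) ^ (i * (n + p)) •
            evalSeq (insertSeq i (n + p) x (evalSeq (fun k => x (i + k)) (circ n p g h))) f +
          ∑ j ∈ Finset.Ico (i + 1) (m + 1), doubleInsertion f g h x i (j + n) := by
    intro i hi
    rw [Finset.mem_range] at hi
    rw [show m + n + 1 = i + (n + 1) + (m - i) by omega, Finset.sum_range_add,
      Finset.sum_range_add, sum_doubleInsertion_add f g h x (Nat.lt_succ_iff.mp hi),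
      Finset.sum_Ico_eq_sum_range, Nat.add_sub_add_right]
    congr 1
    refine Finset.sum_congr rfl fun k _ => congrArg _ ?_
    omega
  rw [evalSeq_circ_circ_left, Finset.sum_congr rfl hsplit, Finset.sum_add_distrib,
    Finset.sum_add_distrib, sum_sum_doubleInsertion_add_of_lt, ← evalSeq_circ,
    ← disjointInsertions]
  abel

/-- The circle product on `⊕_{n ≥ 0} Hom(⊗^{n+1} V, V)`. -/
noncomputable def circSum (K V : Type*) [Field K] [AddCommGroup V] [Module K V] :
    CochainSum K V V →ₗ[K] CochainSum K V V →ₗ[K] CochainSum K V V :=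
  CochainSum.desc fun m =>
    (CochainSum.desc fun n => ((circ m n).compr₂ (CochainSum.of (m + n))).flip).flip

theorem circSum_of_of (f : Cochain K V V m) (g : Cochain K V V n) :
    circSum K V (CochainSum.of m f) (CochainSum.of n g) =
      CochainSum.of (m + n) (circ m n f g) := by
  simp [circSum, CochainSum.desc_of]

theorem circSum_preLie (f : Cochain K V V m) (g : Cochain K V V n) (h : Cochain K V V p) :
    circSum K V (circSum K V (.of m f) (.of n g)) (.of p h) -
        circSum K V (.of m f) (circSum K V (.of n g) (.of p h)) =
      (-1 : K) ^ (n * p) • (circSum K V (circSum K V (.of m f) (.of p h)) (.of n g) -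
        circSum K V (.of m f) (circSum K V (.of p h) (.of n g))) := by
  refine CochainSum.ext_coeff fun k => ext_evalSeq fun x => ?_
  simp only [circSum_of_of, map_sub, map_smul, evalSeq_coeff_of]
  by_cases hk : m + n + p = k
  · rw [if_pos hk, if_pos (by omega), if_pos (by omega), if_pos (by omega), evalSeq_circ_circ,
      evalSeq_circ_circ, add_sub_cancel_left, add_sub_cancel_left, smul_add, smul_smul,
      mul_comm p n, ← mul_pow, neg_one_mul, neg_neg, one_pow, one_smul, add_comm]
  · rw [if_neg hk, if_neg (by omega), if_neg (by omega), if_neg (by omega), sub_self, smul_zero]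

end PreLie

section GerstenhaberBracket

variable {K V : Type*} [Field K] [AddCommGroup V] [Module K V] {m n p : ℕ}

theorem negOnePow_mul_smul (m n : ℕ) (v : V) :
    ((m : ℤ) * n).negOnePow • v = (-1 : K) ^ (m * n) • v := by
  rw [← Nat.cast_mul, Int.negOnePow_def, zpow_natCast]
  rcases Nat.even_or_odd (m * n) with h | h
  · rw [h.neg_one_pow, h.neg_one_pow, one_smul, one_smul]
  · rw [h.neg_one_pow, h.neg_one_pow, Units.neg_smul, one_smul, neg_one_smul]

theorem gerstenhaberBracket_of_of (f : Cochain K V V m) (g : Cochain K V V n) :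
    gerstenhaberBracket K V (.of m f) (.of n g) =
      circSum K V (.of m f) (.of n g) - (-1 : K) ^ (m * n) • circSum K V (.of n g) (.of m f) := by
  rw [circSum_of_of, circSum_of_of]
  simp [gerstenhaberBracket, CochainSum.desc_of, homogeneousBracket]

theorem gerstenhaberBracket_eq {x y : CochainSum K V V} (hx : x ∈ cochainGrading K V V m)
    (hy : y ∈ cochainGrading K V V n) :
    gerstenhaberBracket K V x y = circSum K V x y - (-1 : K) ^ (m * n) • circSum K V y x := by
  obtain ⟨f, rfl⟩ := hx
  obtain ⟨g, rfl⟩ := hy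
  exact gerstenhaberBracket_of_of f g

theorem gerstenhaberBracket_mem {x y : CochainSum K V V} (hx : x ∈ cochainGrading K V V m)
    (hy : y ∈ cochainGrading K V V n) :
    gerstenhaberBracket K V x y ∈ cochainGrading K V V ((m + n : ℕ) : ℤ) := by
  obtain ⟨f, rfl⟩ := hx
  obtain ⟨g, rfl⟩ := hy
  rw [gerstenhaberBracket_of_of, circSum_of_of, circSum_of_of]
  refine sub_mem (of_mem_cochainGrading _) (Submodule.smul_mem _ _ ?_)
  rw [add_comm m n]
  exact of_mem_cochainGrading _

theorem gerstenhaberBracket_antisymm (f : Cochain K V V m) (g : Cochain K V V n) :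
    gerstenhaberBracket K V (.of m f) (.of n g) =
      -((-1 : K) ^ (m * n) • gerstenhaberBracket K V (.of n g) (.of m f)) := by
  rw [gerstenhaberBracket_of_of, gerstenhaberBracket_of_of, smul_sub, smul_smul, mul_comm n m,
    ← mul_pow, neg_one_mul, neg_neg, one_pow, one_smul, neg_sub]

theorem gerstenhaberBracket_jacobi (f : Cochain K V V m) (g : Cochain K V V n)
    (h : Cochain K V V p) :
    gerstenhaberBracket K V (.of m f) (gerstenhaberBracket K V (.of n g) (.of p h)) =
      gerstenhaberBracket K V (gerstenhaberBracket K V (.of m f) (.of n g)) (.of p h) +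
        (-1 : K) ^ (m * n) •
          gerstenhaberBracket K V (.of n g) (gerstenhaberBracket K V (.of m f) (.of p h)) := by
  have hf := of_mem_cochainGrading f
  have hg := of_mem_cochainGrading g
  have hh := of_mem_cochainGrading h
  have hfgh := circSum_preLie f g h
  have hgfh := circSum_preLie g f h
  have hhfg := circSum_preLie h f g
  rw [gerstenhaberBracket_eq hf (gerstenhaberBracket_mem hg hh),
    gerstenhaberBracket_eq (gerstenhaberBracket_mem hf hg) hh,
    gerstenhaberBracket_eq hg (gerstenhaberBracket_mem hf hh),
    gerstenhaberBracket_eq hg hh, gerstenhaberBracket_eq hf hg, gerstenhaberBracket_eq hf hh]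
  simp only [map_sub, map_smul, LinearMap.sub_apply, LinearMap.smul_apply, mul_add, add_mul,
    pow_add, mul_comm n m]
  have hs := neg_one_pow_eq_or K (m * n)
  generalize (-1 : K) ^ (m * n) = s at *
  generalize (-1 : K) ^ (n * p) = t at *
  generalize (-1 : K) ^ (m * p) = r at *
  rcases hs with rfl | rfl
  · linear_combination (norm := module) (-1 : K) • hfgh + (1 : K) • hgfh - (t * r) • hhfg
  · linear_combination (norm := module) (-1 : K) • hfgh + (-1 : K) • hgfh - (t * r) • hhfg

theorem isGradedLieAlgebra_gerstenhaberBracket :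
    IsGradedLieAlgebra (cochainGrading K V V) (gerstenhaberBracket K V) where
  isInternal := isInternal_cochainGrading
  bracket_mem a b x y hx hy := by
    rcases eq_zero_or_exists_of_mem_cochainGrading hx with rfl | ⟨m, f, rfl, rfl⟩
    · simp
    rcases eq_zero_or_exists_of_mem_cochainGrading hy with rfl | ⟨n, g, rfl, rfl⟩
    · simp
    exact_mod_cast gerstenhaberBracket_mem hx hy
  antisymm a b x y hx hy := by
    rcases eq_zero_or_exists_of_mem_cochainGrading hx with rfl | ⟨m, f, rfl, rfl⟩
    · simp
    rcases eq_zero_or_exists_of_mem_cochainGrading hy with rfl | ⟨n, g, rfl, rfl⟩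
    · simp
    rw [negOnePow_mul_smul (K := K), gerstenhaberBracket_antisymm]
  jacobi a b c x y z hx hy hz := by
    rcases eq_zero_or_exists_of_mem_cochainGrading hx with rfl | ⟨m, f, rfl, rfl⟩
    · simp
    rcases eq_zero_or_exists_of_mem_cochainGrading hy with rfl | ⟨n, g, rfl, rfl⟩
    · simp
    rcases eq_zero_or_exists_of_mem_cochainGrading hz with rfl | ⟨p, h, rfl, rfl⟩
    · simp
    rw [negOnePow_mul_smul (K := K), gerstenhaberBracket_jacobi]

end GerstenhaberBracket

section LinearAndBilinearCochains

variable {K V : Type*} [Field K] [AddCommGroup V] [Module K V]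

/-- A linear endomorphism as a cochain of degree `0`. -/
def linCochain (t : V →ₗ[K] V) : Cochain K V V 0 :=
  MultilinearMap.ofSubsingleton K V V (0 : Fin 1) t

theorem evalSeq_linCochain (t : V →ₗ[K] V) (x : ℕ → V) : evalSeq x (linCochain t) = t (x 0) := rfl

/-- The bilinear map `(x, y) ↦ φ(t x, y) + φ(x, t y) - t φ(x, y)`, the failure of `t` to be a
derivation of `φ`. It is the Gerstenhaber bracket `[φ, t]`. -/
def bilinBracket (φ : V →ₗ[K] V →ₗ[K] V) (t : V →ₗ[K] V) : V →ₗ[K] V →ₗ[K] V :=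
  φ.compl₁₂ t LinearMap.id + φ.compl₁₂ LinearMap.id t - φ.compr₂ t

theorem bilinBracket_apply (φ : V →ₗ[K] V →ₗ[K] V) (t : V →ₗ[K] V) (x y : V) :
    bilinBracket φ t x y = φ (t x) y + φ x (t y) - t (φ x y) := rfl

theorem bilinCochain_add (φ ψ : V →ₗ[K] V →ₗ[K] V) :
    bilinCochain (φ + ψ) = bilinCochain φ + bilinCochain ψ := by
  rw [bilinCochain, bilinCochain, bilinCochain, ← map_add]
  rfl

theorem bilinCochain_smul (c : K) (φ : V →ₗ[K] V →ₗ[K] V) :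
    bilinCochain (c • φ) = c • bilinCochain φ := by
  rw [bilinCochain, bilinCochain, ← map_smul]
  rfl

theorem bilinCochain_mem (φ : V →ₗ[K] V →ₗ[K] V) :
    bilinCochain φ ∈ cochainGrading K V V 1 :=
  of_mem_cochainGrading (n := 1) _

theorem gerstenhaberBracket_bilinCochain_linCochain (φ : V →ₗ[K] V →ₗ[K] V) (t : V →ₗ[K] V) :
    gerstenhaberBracket K V (bilinCochain φ) (.of 0 (linCochain t)) =
      bilinCochain (bilinBracket φ t) := by
  refine CochainSum.ext_coeff fun k => ext_evalSeq fun x => ?_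
  simp only [bilinCochain, gerstenhaberBracket_of_of, circSum_of_of, map_sub, map_smul,
    evalSeq_coeff_of, evalSeq_circ, evalSeq_linCochain]
  simp [Finset.sum_range_succ, evalSeq, insertSeq, bilinBracket_apply, ite_sub_ite]

theorem gerstenhaberBracket_bilinCochain_mul {A : Type*} [NonUnitalRing A] [Module K A]
    [IsScalarTower K A A] [SMulCommClass K A A] :
    gerstenhaberBracket K A (bilinCochain (LinearMap.mul K A)) (bilinCochain (LinearMap.mul K A)) =
      0 := by
  have hassoc : circSum K A (bilinCochain (LinearMap.mul K A)) (bilinCochain (LinearMap.mul K A)) =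
      0 := by
    refine CochainSum.ext_coeff fun k => ext_evalSeq fun x => ?_
    rw [bilinCochain, circSum_of_of, evalSeq_coeff_of, evalSeq_circ]
    simp [Finset.sum_range_succ, insertSeq, evalSeq, mul_assoc]
  rw [bilinCochain] at hassoc ⊢
  rw [gerstenhaberBracket_of_of, hassoc, smul_zero, sub_zero]

/-- The bilinear map `(x, y) ↦ (1 - t) φ((1 + t) x, (1 + t) y)`. For `t² = 0` it is the transport
of `φ` along the automorphism `exp t = 1 + t`. -/
def bilinTwist (φ : V →ₗ[K] V →ₗ[K] V) (t : V →ₗ[K] V) : V →ₗ[K] V →ₗ[K] V :=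
  (φ.compl₁₂ (LinearMap.id + t) (LinearMap.id + t)).compr₂ (LinearMap.id - t)

theorem bilinTwist_apply (φ : V →ₗ[K] V →ₗ[K] V) (t : V →ₗ[K] V) (x y : V) :
    bilinTwist φ t x y = φ (x + t x) (y + t y) - t (φ (x + t x) (y + t y)) := rfl

-- The exponential series of `bilinBracket · t`, which ends at `k = 3` when `t² = 0`.
theorem sum_range_smul_iterate_bilinBracket [CharZero K] (φ : V →ₗ[K] V →ₗ[K] V)
    {t : V →ₗ[K] V} (ht : t ∘ₗ t = 0) :
    ∑ k ∈ Finset.range 4, (k.factorial : K)⁻¹ • (bilinBracket · t)^[k] φ = bilinTwist φ t := by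
  have ht' : ∀ x, t (t x) = 0 := LinearMap.congr_fun ht
  refine LinearMap.ext₂ fun x y => ?_
  simp only [Finset.sum_range_succ, Finset.sum_range_zero, Function.iterate_succ_apply',
    Function.iterate_zero, id_eq, LinearMap.add_apply, LinearMap.smul_apply,
    LinearMap.zero_apply, bilinBracket_apply, bilinTwist_apply, map_add, map_sub, ht', map_zero]
  simp only [Nat.factorial, Nat.succ_eq_add_one, Nat.reduceAdd, Nat.reduceMul, Nat.cast_one,
    Nat.cast_ofNat, inv_one, one_smul, zero_add, add_zero, mul_one, sub_zero, zero_sub, sub_self]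
  module

/-- The map `f ↦ t ∘ f - ∑ᵢ f(…, t xᵢ, …)` on cochains of degree `n`. It is the Gerstenhaber
bracket `[t, ·]`. -/
def endAction (t : V →ₗ[K] V) (n : ℕ) : Cochain K V V n →ₗ[K] Cochain K V V n :=
  t.compMultilinearMapₗ (S := K) - (circ n 0).flip (linCochain t)

theorem endAction_apply (t : V →ₗ[K] V) {n : ℕ} (f : Cochain K V V n) (x : Fin (n + 1) → V) :
    endAction t n f x = t (f x) - ∑ i, f (Function.update x i (t (x i))) := by
  have hcirc : circ n 0 f (linCochain t) x = ∑ i, f (Function.update x i (t (x i))) := by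
    simp only [circ_eq_sum_partialComp, mul_zero, pow_zero, one_smul]
    rw [sum_apply]
    refine Finset.sum_congr rfl fun i _ => congrArg f (funext fun j => ?_)
    simp only [insertArgs, Function.update_apply, Fin.ext_iff, Fin.lt_def]
    split_ifs <;> first | rfl | omega
  rw [← hcirc]
  rfl

theorem gerstenhaberBracket_linCochain (t : V →ₗ[K] V) :
    gerstenhaberBracket K V (.of 0 (linCochain t)) =
      CochainSum.desc fun n => CochainSum.of n ∘ₗ endAction t n := by
  refine CochainSum.hom_ext fun n f => CochainSum.ext_coeff fun k => ext_evalSeq fun x => ?_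
  simp only [CochainSum.desc_of, LinearMap.comp_apply, gerstenhaberBracket_of_of, circSum_of_of,
    map_sub, map_smul, evalSeq_coeff_of, endAction]
  by_cases h : n = k
  · rw [if_pos h, if_pos ((zero_add n).trans h), if_pos ((add_zero n).trans h), evalSeq_circ]
    simp only [zero_add, Finset.range_one, evalSeq, Nat.reduceAdd, insertSeq, Fin.val_eq_zero,
      LinearMap.coe_mk, AddHom.coe_mk, Finset.sum_singleton, zero_mul, pow_zero, lt_self_iff_false,
      ↓reduceIte, one_smul, Nat.add_zero, LinearMap.sub_apply,
      LinearMap.compMultilinearMapₗ_apply, LinearMap.flip_apply, sub_apply,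
      LinearMap.compMultilinearMap_apply, sub_left_inj]
    rfl
  · rw [if_neg fun h' => h ((zero_add n).symm.trans h'), if_neg (c := n + 0 = k) h, if_neg h,
      smul_zero, sub_zero]

end LinearAndBilinearCochains

/-! ### The adjoint action of an element of degree zero -/

section AdjointEigenspaces

variable {K L : Type*} [Field K] [AddCommGroup L] [Module K L] {𝓖 : ℤ → Submodule K L}
  {br : L →ₗ[K] L →ₗ[K] L}

theorem iteratedBracket_add (a b : L) (k : ℕ) (x : Fin k → L) :
    iteratedBracket br (a + b) k x = iteratedBracket br a k x + iteratedBracket br b k x := by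
  induction k with
  | zero => rfl
  | succ k ih => simp only [iteratedBracket_succ, ih, map_add, LinearMap.add_apply]

namespace IsGradedLieAlgebra

variable {e : L}

theorem bracket_bracket_of_mem_zero (h : IsGradedLieAlgebra 𝓖 br) (he : e ∈ 𝓖 0) (x y : L) :
    br e (br x y) = br (br e x) y + br x (br e y) := by
  have hx : x ∈ ⨆ k, 𝓖 k := h.iSup_eq_top ▸ Submodule.mem_top
  have hy : y ∈ ⨆ k, 𝓖 k := h.iSup_eq_top ▸ Submodule.mem_top
  induction hx using Submodule.iSup_induction' with
  | mem a x hx =>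
    induction hy using Submodule.iSup_induction' with
    | mem b y hy =>
      have hjacobi := h.jacobi 0 a b e x y he hx hy
      rwa [zero_mul, Int.negOnePow_zero, one_smul] at hjacobi
    | zero => simp only [map_zero, add_zero]
    | add y y' _ _ ih ih' => rw [map_add, map_add, ih, ih', map_add, map_add, map_add]; abel
  | zero => simp only [map_zero, LinearMap.zero_apply, add_zero]
  | add x x' _ _ ih ih' =>
    simp only [map_add, LinearMap.add_apply, ih, ih']
    abel

theorem bracket_mem_eigenspace (h : IsGradedLieAlgebra 𝓖 br) (he : e ∈ 𝓖 0) {v w : K} {x y : L}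
    (hx : x ∈ Module.End.eigenspace (br e) v) (hy : y ∈ Module.End.eigenspace (br e) w) :
    br x y ∈ Module.End.eigenspace (br e) (v + w) := by
  rw [Module.End.mem_eigenspace_iff] at hx hy ⊢
  rw [h.bracket_bracket_of_mem_zero he, hx, hy, map_smul, map_smul, LinearMap.smul_apply,
    add_smul]

theorem iteratedBracket_mem_eigenspace (h : IsGradedLieAlgebra 𝓖 br) (he : e ∈ 𝓖 0) {v w : K}
    {a : L} (ha : a ∈ Module.End.eigenspace (br e) v) {k : ℕ} {x : Fin k → L}
    (hx : ∀ i, x i ∈ Module.End.eigenspace (br e) w) :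
    iteratedBracket br a k x ∈ Module.End.eigenspace (br e) (v + k * w) := by
  induction k with
  | zero => rwa [Nat.cast_zero, zero_mul, add_zero]
  | succ k ih =>
    rw [iteratedBracket_succ, Nat.cast_succ, add_one_mul, ← add_assoc]
    exact h.bracket_mem_eigenspace he (ih fun i => hx i.castSucc) (hx (Fin.last k))

end IsGradedLieAlgebra

end AdjointEigenspaces

/-! ### The V-data of a quasi-twilled associative algebra -/

namespace QuasiTwilledAlgebra

variable {K 𝒜 : Type*} [Field K] [NonUnitalRing 𝒜] [Module K 𝒜]
  [IsScalarTower K 𝒜 𝒜] [SMulCommClass K 𝒜 𝒜] (T : QuasiTwilledAlgebra K 𝒜)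

section Projections

theorem projA_add_projA' (x : 𝒜) : (T.projA x : 𝒜) + T.projA' x = x :=
  Submodule.projection_add_projection_eq_self T.isCompl x

@[simp]
theorem projA_coe (a : T.A) : T.projA (a : 𝒜) = a :=
  Submodule.projectionOnto_apply_left T.isCompl a

@[simp]
theorem projA_coe' (u : T.A') : T.projA (u : 𝒜) = 0 :=
  Submodule.projectionOnto_apply_right T.isCompl u

@[simp]
theorem projA'_coe (a : T.A) : T.projA' (a : 𝒜) = 0 :=
  Submodule.projectionOnto_apply_right T.isCompl.symm a

@[simp]
theorem projA'_coe' (u : T.A') : T.projA' (u : 𝒜) = u :=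
  Submodule.projectionOnto_apply_left T.isCompl.symm u

theorem projA_eq_zero_iff {x : 𝒜} : T.projA x = 0 ↔ x ∈ T.A' :=
  Submodule.projectionOnto_apply_eq_zero_iff T.isCompl

theorem projA_mul_eq_zero (u v : T.A') : T.projA ((u : 𝒜) * v) = 0 :=
  T.projA_eq_zero_iff.mpr (T.mul_mem u u.2 v v.2)

theorem Ω_eq : T.Ω = T.πL + T.ξL + T.ηL + T.βL + T.ρL + T.μL + T.θL := by
  simp only [Ω, πL, ξL, ηL, βL, ρL, μL, θL, ← bilinCochain_add]
  congr 1
  refine LinearMap.ext₂ fun x y => ?_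
  obtain ⟨a, u, rfl⟩ : ∃ (a : T.A) (u : T.A'), (a : 𝒜) + u = x := ⟨_, _, T.projA_add_projA' x⟩
  obtain ⟨b, v, rfl⟩ : ∃ (b : T.A) (v : T.A'), (b : 𝒜) + v = y := ⟨_, _, T.projA_add_projA' y⟩
  rw [LinearMap.mul_apply', ← T.projA_add_projA' (_ * _)]
  simp only [LinearMap.add_apply, LinearMap.compr₂_apply, LinearMap.compl₁₂_apply,
    LinearMap.mul_apply', Submodule.subtype_apply, π, ξ, η, β, ρ, μ, θ, map_add, add_mul, mul_add,
    projA_coe, projA_coe', projA'_coe, projA'_coe', projA_mul_eq_zero, add_zero,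
    Submodule.coe_add, LinearMap.zero_apply, map_zero]
  abel

end Projections

section VData

variable {m n : ℕ}

theorem lift_apply_eq_zero (f : Cochain K T.A' T.A n) {x : Fin (n + 1) → 𝒜} {i : Fin (n + 1)}
    (hi : x i ∈ T.A) : T.lift n f x = 0 :=
  congrArg Subtype.val (f.map_coord_zero i (T.projA'_coe ⟨x i, hi⟩))

theorem component_lift (f : Cochain K T.A' T.A n) : T.component n (T.lift n f) = f := by
  refine MultilinearMap.ext fun u => ?_
  change T.projA (f fun i => T.projA' (u i : 𝒜) : T.A) = f u
  simp only [projA_coe, projA'_coe']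

theorem component_eq_zero_iff {f : Cochain K 𝒜 𝒜 n} :
    T.component n f = 0 ↔ ∀ x : Fin (n + 1) → 𝒜, (∀ i, x i ∈ T.A') → f x ∈ T.A' := by
  refine ⟨fun h x hx => T.projA_eq_zero_iff.mp (MultilinearMap.congr_fun h fun i => ⟨x i, hx i⟩),
    fun h => MultilinearMap.ext fun u => T.projA_eq_zero_iff.mpr (h _ fun i => (u i).2)⟩

theorem circ_lift_lift (f : Cochain K T.A' T.A m) (g : Cochain K T.A' T.A n) :
    circ m n (T.lift m f) (T.lift n g) = 0 := by
  rw [circ_eq_sum_partialComp]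
  refine Finset.sum_eq_zero fun i _ => smul_eq_zero_of_right _ (MultilinearMap.ext fun x => ?_)
  refine T.lift_apply_eq_zero f (i := i) ?_
  simp only [insertArgs, lt_self_iff_false, if_false, if_true]
  exact Subtype.prop _

theorem component_circ_eq_zero {f : Cochain K 𝒜 𝒜 m} {g : Cochain K 𝒜 𝒜 n}
    (hf : T.component m f = 0) (hg : T.component n g = 0) :
    T.component (m + n) (circ m n f g) = 0 := by
  rw [circ_eq_sum_partialComp, map_sum]
  refine Finset.sum_eq_zero fun i _ => ?_
  rw [map_smul]
  refine smul_eq_zero_of_right _ ?_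
  rw [component_eq_zero_iff] at hf hg ⊢
  refine fun x hx => hf _ fun j => ?_
  unfold insertArgs
  split_ifs
  exacts [hx _, hg _ fun _ => hx _, hx _]

theorem liftSum_of (f : Cochain K T.A' T.A n) :
    T.liftSum (.of n f) = .of n (T.lift n f) := by
  rw [liftSum, CochainSum.desc_of, LinearMap.comp_apply]

theorem P_eq_desc :
    T.P = CochainSum.desc fun n => CochainSum.of n ∘ₗ (T.lift n ∘ₗ T.component n) := by
  refine CochainSum.hom_ext fun n f => ?_
  simp only [P, liftSum, componentSum, LinearMap.comp_apply, CochainSum.desc_of]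

theorem P_of (f : Cochain K 𝒜 𝒜 n) : T.P (.of n f) = .of n (T.lift n (T.component n f)) := by
  rw [P_eq_desc, CochainSum.desc_of, LinearMap.comp_apply, LinearMap.comp_apply]

theorem isIdempotentElem_P : IsIdempotentElem T.P :=
  LinearMap.ext fun x => congrArg T.liftSum (T.componentSum_liftSum (T.componentSum x))

theorem range_P : LinearMap.range T.P = T.F := by
  refine le_antisymm (LinearMap.range_comp_le_range _ _) ?_
  rintro _ ⟨c, rfl⟩
  exact ⟨T.liftSum c, congrArg T.liftSum (T.componentSum_liftSum c)⟩

theorem P_eq_self_iff {x : T.L} : T.P x = x ↔ x ∈ T.F := by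
  rw [← range_P]
  exact (LinearMap.IsIdempotentElem.mem_range_iff T.isIdempotentElem_P).symm

theorem P_mem_gradingL (k : ℤ) (x : T.L) (hx : x ∈ T.gradingL k) : T.P x ∈ T.gradingL k := by
  rcases eq_zero_or_exists_of_mem_cochainGrading hx with rfl | ⟨n, f, rfl, rfl⟩
  · rw [map_zero]
    exact zero_mem _
  · rw [P_of]
    exact of_mem_cochainGrading _

theorem bracket_eq_zero_of_mem_F {x y : T.L} (hx : x ∈ T.F) (hy : y ∈ T.F) :
    T.bracket x y = 0 := by
  obtain ⟨c, rfl⟩ := hx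
  obtain ⟨c', rfl⟩ := hy
  suffices h : T.bracket.compl₁₂ T.liftSum T.liftSum = 0 from LinearMap.congr_fun₂ h c c'
  refine CochainSum.hom_ext₂ fun m f n g => ?_
  rw [LinearMap.compl₁₂_apply, liftSum_of, liftSum_of, bracket, gerstenhaberBracket_of_of,
    circSum_of_of, circSum_of_of, circ_lift_lift, circ_lift_lift]
  simp only [map_zero, smul_zero, sub_zero, LinearMap.zero_apply]

theorem P_circSum_eq_zero {f : Cochain K 𝒜 𝒜 m} {g : Cochain K 𝒜 𝒜 n}
    (hf : T.component m f = 0) (hg : T.component n g = 0) :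
    T.P (circSum K 𝒜 (.of m f) (.of n g)) = 0 := by
  rw [circSum_of_of, P_of, T.component_circ_eq_zero hf hg, map_zero, map_zero]

theorem P_bracket_eq_zero {x y : T.L} (hx : T.P x = 0) (hy : T.P y = 0) :
    T.P (T.bracket x y) = 0 := by
  let Q : T.L →ₗ[K] T.L := LinearMap.id - T.P
  suffices h : (T.bracket.compl₁₂ Q Q).compr₂ T.P = 0 by
    have hQ : T.P (T.bracket (Q x) (Q y)) = 0 := LinearMap.congr_fun₂ h x y
    simpa only [Q, LinearMap.sub_apply, LinearMap.id_apply, hx, hy, sub_zero] using hQ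
  have hcomp : ∀ (k : ℕ) (h : Cochain K 𝒜 𝒜 k),
      T.component k (h - T.lift k (T.component k h)) = 0 := fun k h => by
    rw [map_sub, component_lift, sub_self]
  have hQ : ∀ (k : ℕ) (h : Cochain K 𝒜 𝒜 k),
      Q (.of k h) = .of k (h - T.lift k (T.component k h)) := fun k h => by
    rw [LinearMap.sub_apply, LinearMap.id_apply, P_of, ← map_sub]
  refine CochainSum.hom_ext₂ fun m f n g => ?_
  rw [LinearMap.compr₂_apply, LinearMap.compl₁₂_apply, hQ, hQ, bracket,
    gerstenhaberBracket_of_of, map_sub, map_smul, P_circSum_eq_zero T (hcomp m f) (hcomp n g),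
    P_circSum_eq_zero T (hcomp n g) (hcomp m f), smul_zero, sub_zero]
  rfl

theorem P_bilinCochain_eq_zero_iff {φ : 𝒜 →ₗ[K] 𝒜 →ₗ[K] 𝒜} :
    T.P (bilinCochain φ) = 0 ↔ ∀ u v : T.A', T.projA (φ u v) = 0 := by
  rw [bilinCochain, P_of,
    map_eq_zero_iff _ (Function.LeftInverse.injective (CochainSum.coeff_of_self 1)),
    map_eq_zero_iff _ (Function.LeftInverse.injective T.component_lift)]
  exact ⟨fun h u v => MultilinearMap.congr_fun h ![u, v],
    fun h => MultilinearMap.ext fun u => h (u 0) (u 1)⟩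

theorem P_Ω : T.P T.Ω = 0 :=
  T.P_bilinCochain_eq_zero_iff.mpr T.projA_mul_eq_zero

theorem isVData : IsVData T.gradingL T.bracket T.F T.P T.Ω where
  gradedLie := isGradedLieAlgebra_gerstenhaberBracket
  subalgebra := by
    refine ⟨T.range_P ▸ range_eq_iSup_inf iSup_cochainGrading T.P_mem_gradingL,
      fun x hx y hy => ?_⟩
    rw [T.bracket_eq_zero_of_mem_F hx hy]
    exact zero_mem _
  abelian _ hx _ hy := T.bracket_eq_zero_of_mem_F hx hy
  proj := T.isIdempotentElem_P
  range_proj := T.range_P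
  ker_proj := ⟨ker_eq_iSup_inf iSup_cochainGrading T.isIdempotentElem_P T.P_mem_gradingL,
    fun _ hx _ hy => T.P_bracket_eq_zero hx hy⟩
  degree_one := bilinCochain_mem _
  square_zero := gerstenhaberBracket_bilinCochain_mul
  mem_ker := T.P_Ω

theorem isLInfinity [NeZero (2 : K)] : IsLInfinity (V := T.F) T.gradingF T.l where
  toIsCurvedLInfinity := T.isVData.toIsCurvedVData.isCurvedLInfinity
  curvature_eq_zero := MultilinearMap.ext fun _ => Subtype.ext T.P_Ω

end VData

/-! ### Weights and the operations of the `L∞`-algebra -/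

section Weights

variable {n : ℕ}

/-- The projection of `𝒜` onto `A`, as an endomorphism of `𝒜`. -/
noncomputable def endA : 𝒜 →ₗ[K] 𝒜 := T.A.subtype ∘ₗ T.projA

theorem endA_apply (x : 𝒜) : T.endA x = T.projA x := rfl

theorem endA_of_mem {x : 𝒜} (hx : x ∈ T.A) : T.endA x = x :=
  congrArg Subtype.val (T.projA_coe ⟨x, hx⟩)

theorem endA_of_mem' {x : 𝒜} (hx : x ∈ T.A') : T.endA x = 0 :=
  congrArg Subtype.val (T.projA_coe' ⟨x, hx⟩)

/-- The Euler element of `L`, the projection onto `A` in degree `0`. Its adjoint action multiplies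
a map from a tensor product of copies of `A` and `A'` by the weight of the map, which is `1` for
values in `A` and `0` for values in `A'`, minus the number of copies of `A` in the source. -/
noncomputable def euler : T.L := .of 0 (linCochain T.endA)

theorem euler_mem : T.euler ∈ T.gradingL 0 := of_mem_cochainGrading (n := 0) _

theorem bracket_euler : T.bracket T.euler =
    CochainSum.desc fun n => CochainSum.of n ∘ₗ endAction T.endA n :=
  gerstenhaberBracket_linCochain T.endA

/-- The elements of `L` of weight `w`. -/
noncomputable def weightSpace (w : K) : Submodule K T.L :=
  Module.End.eigenspace (T.bracket T.euler) w

theorem mem_weightSpace_iff {w : K} {x : T.L} :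
    x ∈ T.weightSpace w ↔ T.bracket T.euler x = w • x :=
  Module.End.mem_eigenspace_iff

theorem component_endAction (f : Cochain K 𝒜 𝒜 n) :
    T.component n (endAction T.endA n f) = T.component n f := by
  refine MultilinearMap.ext fun u => ?_
  change T.projA (endAction T.endA n f fun i => (u i : 𝒜)) = T.projA (f fun i => (u i : 𝒜))
  rw [endAction_apply, Finset.sum_eq_zero, sub_zero, endA_apply, projA_coe]
  intro i _
  refine f.map_coord_zero i ?_
  rw [Function.update_self, T.endA_of_mem' (u i).2]

theorem endAction_lift (f : Cochain K T.A' T.A n) :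
    endAction T.endA n (T.lift n f) = T.lift n f := by
  refine MultilinearMap.ext fun x => ?_
  rw [endAction_apply, Finset.sum_eq_zero, sub_zero]
  · exact T.endA_of_mem (Subtype.prop (f fun i => T.projA' (x i)))
  intro i _
  refine T.lift_apply_eq_zero f (i := i) ?_
  rw [Function.update_self]
  exact Subtype.prop _

theorem P_bracket_euler (x : T.L) : T.P (T.bracket T.euler x) = T.P x := by
  suffices h : T.P ∘ₗ T.bracket T.euler = T.P from LinearMap.congr_fun h x
  refine CochainSum.hom_ext fun n f => ?_
  rw [LinearMap.comp_apply, bracket_euler, CochainSum.desc_of, LinearMap.comp_apply, P_of,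
    component_endAction, P_of]

theorem P_eq_zero_of_mem_weightSpace {w : K} (hw : w ≠ 1) {x : T.L} (hx : x ∈ T.weightSpace w) :
    T.P x = 0 := by
  have h : (w - 1) • T.P x = 0 := by
    rw [sub_smul, one_smul, ← map_smul, ← T.mem_weightSpace_iff.mp hx, P_bracket_euler, sub_self]
  exact (smul_eq_zero.mp h).resolve_left (sub_ne_zero.mpr hw)

theorem endA_apply_of_endAction_eq {f : Cochain K 𝒜 𝒜 n} (hf : endAction T.endA n f = f)
    {x : Fin (n + 1) → 𝒜} {s : Finset (Fin (n + 1))} (hs : ∀ i ∈ s, x i ∈ T.A)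
    (hs' : ∀ i ∉ s, x i ∈ T.A') : T.endA (f x) = ((s.card : K) + 1) • f x := by
  have hterm : ∀ i, f (Function.update x i (T.endA (x i))) = if i ∈ s then f x else 0 := by
    intro i
    split_ifs with hi
    · rw [T.endA_of_mem (hs i hi), Function.update_eq_self]
    · exact f.map_coord_zero i (by rw [Function.update_self, T.endA_of_mem' (hs' i hi)])
  have h := MultilinearMap.congr_fun hf x
  rw [endAction_apply, sub_eq_iff_eq_add'] at h
  rw [h, Finset.sum_congr rfl fun i _ => hterm i, Finset.sum_ite_mem, Finset.univ_inter,
    Finset.sum_const, add_smul, one_smul, Nat.cast_smul_eq_nsmul]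

-- The eigenvalue `#s + 1` of the projection onto `A` would be neither `0` nor `1`.
theorem apply_eq_zero_of_endAction_eq [CharZero K] {f : Cochain K 𝒜 𝒜 n}
    (hf : endAction T.endA n f = f) {x : Fin (n + 1) → 𝒜} {s : Finset (Fin (n + 1))}
    (hs : ∀ i ∈ s, x i ∈ T.A) (hs' : ∀ i ∉ s, x i ∈ T.A') (hne : s.Nonempty) : f x = 0 := by
  have heigen := T.endA_apply_of_endAction_eq hf hs hs'
  have hidem : T.endA (T.endA (f x)) = T.endA (f x) := T.endA_of_mem (Subtype.prop _)
  have hsmul : ((s.card : K) + 1) • (s.card : K) • f x = 0 := by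
    rw [heigen, map_smul, heigen, ← sub_eq_zero, ← smul_sub] at hidem
    rwa [add_smul _ _ (f x), one_smul, add_sub_cancel_right] at hidem
  have hcard : (s.card : K) ≠ 0 := Nat.cast_ne_zero.mpr hne.card_ne_zero
  exact (smul_eq_zero.mp ((smul_eq_zero.mp hsmul).resolve_left
    (Nat.cast_add_one_ne_zero _))).resolve_left hcard

theorem lift_component_of_endAction_eq [CharZero K] {f : Cochain K 𝒜 𝒜 n}
    (hf : endAction T.endA n f = f) : T.lift n (T.component n f) = f := by
  refine MultilinearMap.ext fun x => ?_
  let a : Fin (n + 1) → 𝒜 := fun i => T.projA (x i)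
  let u : Fin (n + 1) → 𝒜 := fun i => T.projA' (x i)
  have hmem : ∀ s : Finset (Fin (n + 1)), ∀ i ∈ s, s.piecewise a u i ∈ T.A := fun s i hi => by
    rw [Finset.piecewise_eq_of_mem _ _ _ hi]
    exact Subtype.prop _
  have hmem' : ∀ s : Finset (Fin (n + 1)), ∀ i ∉ s, s.piecewise a u i ∈ T.A' := fun s i hi => by
    rw [Finset.piecewise_eq_of_notMem _ _ _ hi]
    exact Subtype.prop _
  have hu : T.endA (f u) = f u := by
    simpa using T.endA_apply_of_endAction_eq hf (hmem ∅) (hmem' ∅)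
  calc T.lift n (T.component n f) x = T.endA (f u) := rfl
    _ = ∑ s : Finset (Fin (n + 1)), f (s.piecewise a u) := by
        rw [Finset.sum_eq_single ∅, Finset.piecewise_empty, hu]
        · exact fun s _ hs => T.apply_eq_zero_of_endAction_eq hf (hmem s) (hmem' s)
            (Finset.nonempty_iff_ne_empty.mpr hs)
        · exact fun h => (h (Finset.mem_univ ∅)).elim
    _ = f x := by
        rw [← MultilinearMap.map_add_univ]
        exact congrArg f (funext fun i => T.projA_add_projA' (x i))

theorem F_eq_weightSpace_one [CharZero K] : T.F = T.weightSpace 1 := by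
  ext x
  rw [← P_eq_self_iff, mem_weightSpace_iff, one_smul, P_eq_desc, bracket_euler]
  refine ⟨fun h => ?_, fun h => CochainSum.ext_coeff fun n => ?_⟩
  · rw [← P_eq_desc, P_eq_self_iff] at h
    obtain ⟨c, rfl⟩ := h
    suffices hc : CochainSum.desc (fun n => CochainSum.of n ∘ₗ endAction T.endA n) ∘ₗ T.liftSum =
        T.liftSum from LinearMap.congr_fun hc c
    refine CochainSum.hom_ext fun n f => ?_
    rw [LinearMap.comp_apply, liftSum_of, CochainSum.desc_of, LinearMap.comp_apply, endAction_lift]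
  · rw [CochainSum.coeff_desc_of_comp]
    refine T.lift_component_of_endAction_eq ?_
    rw [← CochainSum.coeff_desc_of_comp fun n => endAction T.endA n, h]

theorem bilinCochain_mem_weightSpace {φ : 𝒜 →ₗ[K] 𝒜 →ₗ[K] 𝒜} {w : K}
    (h : ∀ x y, φ (T.endA x) y + φ x (T.endA y) - T.endA (φ x y) = -w • φ x y) :
    bilinCochain φ ∈ T.weightSpace w := by
  have hφ : bilinBracket φ T.endA = -w • φ := LinearMap.ext₂ h
  have hanti := T.isVData.gradedLie.antisymm 0 1 T.euler (bilinCochain φ) T.euler_mem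
    (bilinCochain_mem φ)
  rw [zero_mul, Int.negOnePow_zero, one_smul, bracket, euler,
    gerstenhaberBracket_bilinCochain_linCochain, hφ, bilinCochain_smul, neg_smul, neg_neg] at hanti
  exact T.mem_weightSpace_iff.mpr hanti

theorem ξL_add_ηL_add_βL_mem_weightSpace : T.ξL + T.ηL + T.βL ∈ T.weightSpace 0 := by
  refine add_mem (add_mem ?_ ?_) ?_ <;>
    exact T.bilinCochain_mem_weightSpace fun x y => by simp [endA_apply]

theorem πL_add_ρL_add_μL_mem_weightSpace : T.πL + T.ρL + T.μL ∈ T.weightSpace (-1) := by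
  refine add_mem (add_mem ?_ ?_) ?_ <;>
    exact T.bilinCochain_mem_weightSpace fun x y => by simp [endA_apply]

theorem θL_mem_weightSpace : T.θL ∈ T.weightSpace (-2) :=
  T.bilinCochain_mem_weightSpace fun x y => by simp [endA_apply, two_smul]

end Weights

section Operations

variable [CharZero K]

theorem P_iteratedBracket {w : ℤ} {a : T.L} (ha : a ∈ T.weightSpace w) {k : ℕ}
    (x : Fin k → T.F) :
    T.P (iteratedBracket T.bracket a k fun i => x i) =
      if w + k = 1 then iteratedBracket T.bracket a k fun i => x i else 0 := by
  have hx : ∀ i, (x i : T.L) ∈ T.weightSpace 1 := fun i => T.F_eq_weightSpace_one ▸ (x i).2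
  have hmem : iteratedBracket T.bracket a k (fun i => x i) ∈ T.weightSpace (w + k * 1) :=
    T.isVData.gradedLie.iteratedBracket_mem_eigenspace T.euler_mem ha hx
  have hcast : (w : K) + k * 1 = 1 ↔ w + k = 1 := by
    rw [mul_one]
    exact_mod_cast Iff.rfl
  split_ifs with hw
  · rw [hcast.mpr hw] at hmem
    exact T.P_eq_self_iff.mpr (T.F_eq_weightSpace_one.ge hmem)
  · exact T.P_eq_zero_of_mem_weightSpace (mt hcast.mp hw) hmem

theorem coe_l_eq {k : ℕ} (x : Fin k → T.F) :
    (T.l k x : T.L) =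
      (if k = 1 then iteratedBracket T.bracket (T.ξL + T.ηL + T.βL) k fun i => x i else 0) +
      (if k = 2 then iteratedBracket T.bracket (T.πL + T.ρL + T.μL) k fun i => x i else 0) +
      (if k = 3 then iteratedBracket T.bracket T.θL k fun i => x i else 0) := by
  have hΩ : T.Ω = T.ξL + T.ηL + T.βL + (T.πL + T.ρL + T.μL) + T.θL := by
    rw [Ω_eq]
    abel
  have h₀ := T.P_iteratedBracket (w := 0)
    (by exact_mod_cast T.ξL_add_ηL_add_βL_mem_weightSpace) x
  have h₁ := T.P_iteratedBracket (w := -1)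
    (by exact_mod_cast T.πL_add_ρL_add_μL_mem_weightSpace) x
  have h₂ := T.P_iteratedBracket (w := -2) (by exact_mod_cast T.θL_mem_weightSpace) x
  change T.P (iteratedBracket T.bracket T.Ω k fun i => (x i : T.L)) = _
  rw [hΩ, iteratedBracket_add, iteratedBracket_add, map_add, map_add, h₀, h₁, h₂,
    if_congr (show (0 : ℤ) + k = 1 ↔ k = 1 by omega) rfl rfl,
    if_congr (show (-1 : ℤ) + k = 1 ↔ k = 2 by omega) rfl rfl,
    if_congr (show (-2 : ℤ) + k = 1 ↔ k = 3 by omega) rfl rfl]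

theorem l_one (f : T.F) : (T.l 1 ![f] : T.L) = T.bracket (T.ξL + T.ηL + T.βL) f := by
  rw [coe_l_eq, if_pos rfl, if_neg (by decide), if_neg (by decide), add_zero, add_zero]
  rfl

theorem l_two (f₁ f₂ : T.F) : (T.l 2 ![f₁, f₂] : T.L) =
    T.bracket (T.bracket (T.πL + T.ρL + T.μL) f₁) f₂ := by
  rw [coe_l_eq, if_neg (by decide), if_pos rfl, if_neg (by decide), zero_add, add_zero]
  rfl

theorem l_three (f₁ f₂ f₃ : T.F) : (T.l 3 ![f₁, f₂, f₃] : T.L) =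
    T.bracket (T.bracket (T.bracket T.θL f₁) f₂) f₃ := by
  rw [coe_l_eq, if_neg (by decide), if_neg (by decide), if_pos rfl, zero_add, zero_add]
  rfl

theorem l_eq_zero (k : ℕ) (hk : 4 ≤ k) : T.l k = 0 := by
  refine MultilinearMap.ext fun x => Subtype.ext ?_
  rw [coe_l_eq, if_neg (by omega), if_neg (by omega), if_neg (by omega), add_zero, add_zero]
  rfl

end Operations

/-! ### Maurer-Cartan elements -/

section MaurerCartan

theorem isMaurerCartan_iff_sum_range_eq_zero [CharZero K] {x : T.F} (hx : x ∈ T.gradingF 0) :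
    IsMaurerCartan (V := T.F) T.gradingF T.l x ↔
      ∑ k ∈ Finset.range 4, (k.factorial : K)⁻¹ • T.l k (fun _ => x) = 0 := by
  have hlt : ∀ k : ℕ, (k.factorial : K)⁻¹ • T.l k (fun _ => x) ≠ 0 → k < 4 := by
    intro k hk
    contrapose! hk
    rw [T.l_eq_zero k hk, zero_apply, smul_zero]
  have hsum := finsum_eq_sum_of_support_subset (s := Finset.range 4)
    (fun k : ℕ => (k.factorial : K)⁻¹ • T.l k (fun _ => x)) fun k hk => by simpa using hlt k hk
  rw [← hsum]
  exact ⟨fun h => h.equation, fun h => ⟨hx, (Set.finite_lt_nat 4).subset hlt, h⟩⟩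

/-- A map `A' → A`, as an endomorphism of `𝒜`. -/
noncomputable def endOfMap (B : T.A' →ₗ[K] T.A) : 𝒜 →ₗ[K] 𝒜 := T.A.subtype ∘ₗ B ∘ₗ T.projA'

theorem endOfMap_coe (B : T.A' →ₗ[K] T.A) (u : T.A') : T.endOfMap B u = B u :=
  congrArg (fun v => (B v : 𝒜)) (T.projA'_coe' u)

theorem endOfMap_comp_self (B : T.A' →ₗ[K] T.A) : T.endOfMap B ∘ₗ T.endOfMap B = 0 := by
  refine LinearMap.ext fun x => ?_
  simp [endOfMap]

theorem coe_ofMap (B : T.A' →ₗ[K] T.A) :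
    (T.ofMap B : T.L) = .of 0 (linCochain (T.endOfMap B)) :=
  T.liftSum_of _

theorem ofMap_mem (B : T.A' →ₗ[K] T.A) : T.ofMap B ∈ T.gradingF 0 := by
  change (T.ofMap B : T.L) ∈ T.gradingL 0
  rw [coe_ofMap]
  exact of_mem_cochainGrading (n := 0) _

theorem coe_l_ofMap (B : T.A' →ₗ[K] T.A) (k : ℕ) :
    (T.l k (fun _ => T.ofMap B) : T.L) =
      T.P (bilinCochain ((bilinBracket · (T.endOfMap B))^[k] (LinearMap.mul K 𝒜))) := by
  refine congrArg T.P ?_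
  change iteratedBracket T.bracket T.Ω k (fun _ => (T.ofMap B : T.L)) = _
  induction k with
  | zero => rfl
  | succ k ih =>
    rw [iteratedBracket_succ, Function.iterate_succ_apply',
      ← gerstenhaberBracket_bilinCochain_linCochain, ← ih, ← coe_ofMap]
    rfl

theorem coe_sum_smul_l_ofMap [CharZero K] (B : T.A' →ₗ[K] T.A) :
    ((∑ k ∈ Finset.range 4, (k.factorial : K)⁻¹ • T.l k (fun _ => T.ofMap B) : T.F) : T.L) =
      T.P (bilinCochain (bilinTwist (LinearMap.mul K 𝒜) (T.endOfMap B))) := by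
  rw [← sum_range_smul_iterate_bilinBracket _ (T.endOfMap_comp_self B)]
  simp only [Finset.sum_range_succ, Finset.sum_range_zero, zero_add, Submodule.coe_add,
    Submodule.coe_smul, coe_l_ofMap, bilinCochain_add, bilinCochain_smul, map_add, map_smul]

/-- The graph `{u + B u}` of `B` is a subalgebra of `𝒜`. An element `x` of `𝒜` lies on the graph
when its `A`-component is the image under `B` of its `A'`-component. -/
def IsGraphSubalgebra (B : T.A' →ₗ[K] T.A) : Prop :=
  ∀ u v : T.A', T.projA ((u + B u) * (v + B v) : 𝒜) = B (T.projA' ((u + B u) * (v + B v) : 𝒜))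

theorem isLeftDeformationMap_iff_isGraphSubalgebra {B : T.A' →ₗ[K] T.A} :
    T.IsLeftDeformationMap B ↔ T.IsGraphSubalgebra B := by
  refine forall₂_congr fun u v => Eq.congr ?_ (congrArg B ?_)
  · simp only [π, ξ, η, LinearMap.compr₂_apply, LinearMap.compl₁₂_apply, LinearMap.mul_apply',
      Submodule.subtype_apply, add_mul, mul_add, map_add, projA_mul_eq_zero]
    abel
  · simp only [β, ρ, μ, θ, LinearMap.compr₂_apply, LinearMap.compl₁₂_apply, LinearMap.mul_apply',
      Submodule.subtype_apply, add_mul, mul_add, map_add]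
    abel

theorem isMaurerCartan_ofMap_iff_isGraphSubalgebra [CharZero K] {B : T.A' →ₗ[K] T.A} :
    IsMaurerCartan (V := T.F) T.gradingF T.l (T.ofMap B) ↔ T.IsGraphSubalgebra B := by
  rw [T.isMaurerCartan_iff_sum_range_eq_zero (T.ofMap_mem B), ← ZeroMemClass.coe_eq_zero,
    coe_sum_smul_l_ofMap, P_bilinCochain_eq_zero_iff]
  refine forall₂_congr fun u v => ?_
  rw [bilinTwist_apply, endOfMap_coe, endOfMap_coe, map_sub, sub_eq_zero]
  exact Eq.congr rfl (T.projA_coe _)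

theorem isLeftDeformationMap_iff_isMaurerCartan [CharZero K] (B : T.A' →ₗ[K] T.A) :
    T.IsLeftDeformationMap B ↔ IsMaurerCartan (V := T.F) T.gradingF T.l (T.ofMap B) :=
  T.isLeftDeformationMap_iff_isGraphSubalgebra.trans
    T.isMaurerCartan_ofMap_iff_isGraphSubalgebra.symm

end MaurerCartan

end QuasiTwilledAlgebra

theorem theorem4 {K 𝒜 : Type*} [Field K] [CharZero K] [NonUnitalRing 𝒜] [Module K 𝒜]
    [IsScalarTower K 𝒜 𝒜] [SMulCommClass K 𝒜 𝒜] (T : QuasiTwilledAlgebra K 𝒜) :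
    T.Ω = T.πL + T.ξL + T.ηL + T.βL + T.ρL + T.μL + T.θL ∧
    IsVData T.gradingL T.bracket T.F T.P T.Ω ∧
    IsLInfinity (V := T.F) T.gradingF T.l ∧
    (∀ f : T.F, (T.l 1 ![f] : T.L) = T.bracket (T.ξL + T.ηL + T.βL) f) ∧
    (∀ f₁ f₂ : T.F, (T.l 2 ![f₁, f₂] : T.L) =
      T.bracket (T.bracket (T.πL + T.ρL + T.μL) f₁) f₂) ∧
    (∀ f₁ f₂ f₃ : T.F, (T.l 3 ![f₁, f₂, f₃] : T.L) =
      T.bracket (T.bracket (T.bracket T.θL f₁) f₂) f₃) ∧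
    (∀ k : ℕ, 4 ≤ k → T.l k = 0) ∧
    (∀ B : T.A' →ₗ[K] T.A,
      T.IsLeftDeformationMap B ↔ IsMaurerCartan (V := T.F) T.gradingF T.l (T.ofMap B)) :=
  ⟨T.Ω_eq, T.isVData, T.isLInfinity, T.l_one, T.l_two, T.l_three, T.l_eq_zero,
    T.isLeftDeformationMap_iff_isMaurerCartan⟩
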